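/- Let $K$ be a commutative locally compact hypergroup (in the sense of Dunkl, Jewett and Spector), with convolution $(x,y)\mapsto\omega(x,y)$, where $\omega(x,y)=\delta_x*\delta_y$ is a Radon probability measure with compact support, involution $x\mapsto\tilde x$ and identity $e$. For $A,B\subseteq K$ put $A\cdot B=\bigcup_{a\in A,\,b\in B}\operatorname{supp}\omega(a,b)$. A subhypergroup of $K$ is a nonempty closed set $H\subseteq K$ with $H\cdot H=H$ and $\tilde H=H$; it is called a subgroup if $\omega(x,y)$ is a point measure for all $x,y\in H$. Let $H$ be a subgroup or a compact subhypergroup of $K$, let $K/H=\{xH:x\in K\}$, $xH=\{x\}\cdot H$, carry the quotient topology, let $p:K\to K/H$, $p(x)=xH$, be the canonical projection, and equip $K/H$ with the hypergroup structure $\omega(xH,yH)=\int_K\delta_{zH}\,d\omega(x,y)(z)$, $(xH)^{\sim}=\tilde xH$. For a commutative hypergroup $L$ let $\widehat L$ be the set of all nonzero bounded continuous $\alpha:L\to\mathbb C$ with $\int\alpha\,d\omega(x,y)=\alpha(x)\alpha(y)$ and $\alpha(\tilde x)=\overline{\alpha(x)}$ for all $x,y\in L$, and put $T_xf(y)=\int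 f\,d\omega(x,y)$. Let $L^\infty(L)$ be formed with respect to a Haar measure of $L$, that is, a nonzero Radon measure $m$ with $\int T_xf\,dm=\int f\,dm$ for all $x\in L$ and $f\in C_c(L)$. For $\alpha\in\widehat L$, the hypergroup $L$ is called $\alpha$-amenable if there is a bounded linear functional $m_\alpha$ on $L^\infty(L)$ with $m_\alpha(\alpha)=1$ and $m_\alpha(T_xf)=\alpha(x)\,m_\alpha(f)$ for all $f\in L^\infty(L)$ and $x\in L$. Then for every $\gamma\in\widehat{K/H}$ the function $\gamma\circ p$ belongs to $\widehat K$, and $K/H$ is $\gamma$-amenable if and only if $K$ is $(\gamma\circ p)$-amenable. -/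

import Mathlib

open MeasureTheory
open scoped BoundedContinuousFunction

noncomputable section

/-- The data of a convolution on a Borel space: the measures `conv x y = δ_x * δ_y`
(written `ω(x, y)`), an involution and a distinguished point. No law is imposed here. -/
structure ConvData (K : Type*) [MeasurableSpace K] where
  conv : K → K → Measure K
  inv : K → K
  one : K

/-- The axioms of a commutative hypergroup (in the sense of Dunkl, Jewett and Spector) on a
locally compact Hausdorff space `K`. -/
structure IsCommHypergroup {K : Type*} [TopologicalSpace K] [T2Space K] [LocallyCompactSpace K]
    [MeasurableSpace K] [BorelSpace K] (S : ConvData K) : Prop where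
  /-- each `ω(x, y)` is a Radon probability measure with compact support -/
  isProbability : ∀ x y, IsProbabilityMeasure (S.conv x y)
  regular : ∀ x y, (S.conv x y).Regular
  isCompact_support : ∀ x y, IsCompact (S.conv x y).support
  /-- `(x, y) ↦ ω(x, y)` is continuous for the weak topology on probability measures -/
  continuous_conv : ∀ f : K →ᵇ ℝ, Continuous fun q : K × K => ∫ t, f t ∂S.conv q.1 q.2
  /-- `(x, y) ↦ supp ω(x, y)` is continuous for the Michael (Vietoris) topology -/
  continuous_support : @Continuous (K × K) (Set K) _ (TopologicalSpace.vietoris K)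
    fun q => (S.conv q.1 q.2).support
  /-- `(δ_x * δ_y) * δ_z = δ_x * (δ_y * δ_z)` -/
  assoc : ∀ (f : K →ᵇ ℝ) (x y z : K),
    ∫ u, (∫ t, f t ∂S.conv u z) ∂S.conv x y = ∫ u, (∫ t, f t ∂S.conv x u) ∂S.conv y z
  one_conv : ∀ x, S.conv S.one x = Measure.dirac x
  comm : ∀ x y, S.conv x y = S.conv y x
  continuous_inv : Continuous S.inv
  inv_inv : ∀ x, S.inv (S.inv x) = x
  map_inv : ∀ x y, (S.conv x y).map S.inv = S.conv (S.inv y) (S.inv x)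
  one_mem_support : ∀ x y, S.one ∈ (S.conv x y).support ↔ x = S.inv y

namespace ConvData

section Basic

variable {K : Type*} [TopologicalSpace K] [MeasurableSpace K] (S : ConvData K)

/-- The product `A · B = ⋃_{a ∈ A, b ∈ B} supp ω(a, b)` of two subsets. -/
def setMul (A B : Set K) : Set K := ⋃ a ∈ A, ⋃ b ∈ B, (S.conv a b).support

/-- Subhypergroups: nonempty closed sets `H` with `H · H = H` and `H~ = H`. -/
structure IsSubhypergroup (H : Set K) : Prop where
  nonempty : H.Nonempty
  isClosed : IsClosed H
  mul_eq : S.setMul H H = H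
  inv_eq : S.inv '' H = H

/-- Subgroups: subhypergroups on which the convolution of two points is a point. -/
structure IsSubgroup (H : Set K) : Prop extends S.IsSubhypergroup H where
  conv_eq_dirac : ∀ x ∈ H, ∀ y ∈ H, ∃ z ∈ H, S.conv x y = Measure.dirac z

/-- The translate `T_x f (y) = ∫ f dω(x, y)`. -/
def translate (x : K) (f : K → ℂ) (y : K) : ℂ := ∫ t, f t ∂S.conv x y

/-- The characters in `K^`: nonzero bounded continuous functions `α` with
`∫ α dω(x, y) = α(x) α(y)` and `α(x~) = conj α(x)`. -/
structure IsCharacter (α : K →ᵇ ℂ) : Prop where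
  ne_zero : α ≠ 0
  map_conv : ∀ x y, ∫ t, α t ∂S.conv x y = α x * α y
  map_inv : ∀ x, α (S.inv x) = starRingEnd ℂ (α x)

/-- Haar measures: nonzero Radon measures `m` with `∫ T_x f dm = ∫ f dm` for all `x` and all
`f ∈ C_c(K)`. The Radon measure is taken inner regular on all Borel sets, so that locally null
sets are null and `L^∞(K, m)` is the usual space also if `m` is not `σ`-finite. -/
structure IsHaar (m : Measure K) : Prop where
  ne_zero : m ≠ 0
  finiteOnCompacts : IsFiniteMeasureOnCompacts m
  innerRegular : m.InnerRegular
  integral_translate : ∀ (x : K) (f : K → ℂ), Continuous f → HasCompactSupport f →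
    ∫ y, S.translate x f y ∂m = ∫ y, f y ∂m

end Basic

end ConvData

theorem memLp_top_of_bcf {K : Type*} [TopologicalSpace K] [MeasurableSpace K] [BorelSpace K]
    (m : Measure K) (α : K →ᵇ ℂ) : MemLp α ⊤ m :=
  memLp_top_of_bound α.continuous.aestronglyMeasurable ‖α‖
    (Filter.Eventually.of_forall fun x => α.norm_coe_le_norm x)

namespace ConvData

/-- `α`-amenability, i.e. `α`-amenability of `L^∞(K) = L^∞(K, m)`: there is a bounded linear
functional `M` on `L^∞(K)` with `M(α) = 1` and `M(T_x f) = α(x) M(f)` for all `f ∈ L^∞(K)`,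
`x ∈ K`. Here `g` runs over the (unique) class in `L^∞(K)` that is represented by `T_x f`. -/
def IsAmenable {K : Type*} [TopologicalSpace K] [MeasurableSpace K] [BorelSpace K]
    (S : ConvData K) (m : Measure K) (α : K →ᵇ ℂ) : Prop :=
  ∃ M : Lp ℂ ⊤ m →L[ℂ] ℂ,
    M ((memLp_top_of_bcf m α).toLp α) = 1 ∧
    ∀ (x : K) (f g : Lp ℂ ⊤ m), g =ᵐ[m] S.translate x f → M g = α x * M f

section Quotient

variable {K : Type*} [TopologicalSpace K] [MeasurableSpace K] (S : ConvData K) (H : Set K)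

/-- The coset `xH = {x} · H`. -/
def coset (x : K) : Set K := S.setMul {x} H

/-- The space `K/H = {xH : x ∈ K}` of cosets: two points are identified if their cosets
agree. -/
def QuotSpace : Type _ := Quotient (Setoid.ker (S.coset H))

/-- The canonical projection `p : K → K/H`, `x ↦ xH`. -/
def proj (x : K) : S.QuotSpace H := Quotient.mk (Setoid.ker (S.coset H)) x

/-- The quotient topology. -/
instance : TopologicalSpace (S.QuotSpace H) :=
  inferInstanceAs (TopologicalSpace (Quotient (Setoid.ker (S.coset H))))

/-- `K/H` carries the Borel sets of the quotient topology. -/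
instance : MeasurableSpace (S.QuotSpace H) := _root_.borel _

instance : BorelSpace (S.QuotSpace H) := ⟨rfl⟩

theorem continuous_proj : Continuous (S.proj H) := continuous_quotient_mk'

/-- A point of the coset `a`. -/
def rep (a : S.QuotSpace H) : K := Quotient.out a

theorem proj_rep (a : S.QuotSpace H) : S.proj H (S.rep H a) = a := Quotient.out_eq a

/-- The convolution `ω(xH, yH) = ∫ δ_{zH} dω(x, y)(z)`, i.e. the image of `ω(x, y)` under `p`,
with the involution `(xH)~ = x~H` and the identity `eH`. They are computed at representatives of
the cosets; for a subgroup or a compact subhypergroup `H` of a commutative hypergroup they do not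
depend on the choice of these. -/
def quot : ConvData (S.QuotSpace H) where
  conv a b := (S.conv (S.rep H a) (S.rep H b)).map (S.proj H)
  inv a := S.proj H (S.inv (S.rep H a))
  one := S.proj H S.one

/-- The function `γ ∘ p` on `K`, for `γ ∈ C^b(K/H)`. -/
def pullback (γ : S.QuotSpace H →ᵇ ℂ) : K →ᵇ ℂ :=
  γ.compContinuous ⟨S.proj H, S.continuous_proj H⟩

end Quotient

end ConvData

end

/-!
The projection `p : K → K/H` is nonsingular for the Haar measures, so `f ↦ f ∘ p` maps `L^∞(K/H)`
into `L^∞(K)` and intertwines the translations; composing with it turns a `γ ∘ p`-invariant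
functional on `L^∞(K)` into a `γ`-invariant functional on `L^∞(K/H)`.

For the converse one needs an intertwining operator in the other direction. Smearing with a kernel
in `C_c(K)` maps `L^∞(K)` into `C^b(K)`. As `γ ∘ p` is `1` on `H`, the commuting contractions `T_h`,
`h ∈ H`, fix `γ ∘ p`, and there is an `H`-invariant functional `μ` on `C^b(K)` with `μ(γ ∘ p) ≠ 0`.
If `f` is a smeared function, then `x ↦ μ(T_x f)` is `H`-invariant, hence a function on `K/H`; this
gives an operator `L^∞(K) → C^b(K/H)` that intertwines the translations and maps `γ ∘ p` to a
nonzero multiple of `γ`.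
-/

noncomputable section

open Set Filter Topology
open scoped CompactlySupported

/-! ### Integrals against Radon measures -/

section CompactSupport

variable {X E : Type*} [TopologicalSpace X] [NormedAddCommGroup E]

theorem exists_bump [T2Space X] [LocallyCompactSpace X] {C U : Set X} (hC : IsCompact C)
    (hU : IsOpen U) (hCU : C ⊆ U) :
    ∃ v : C_c(X, ℝ), EqOn v 1 C ∧ tsupport v ⊆ U ∧ ∀ x, v x ∈ Icc 0 1 := by
  obtain ⟨v, hv1, hvc, hvU, hv⟩ := exists_continuousMap_one_of_isCompact_subset_isOpen hC hU hCU
  exact ⟨⟨v, hvc⟩, hv1, hvU, hv⟩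

theorem continuous_integral_of_forall_notMem_eq_zero {Y : Type*} [TopologicalSpace Y]
    [MeasurableSpace Y] [OpensMeasurableSpace Y] {ν : Measure Y} [IsFiniteMeasureOnCompacts ν]
    {F : X → Y → ℝ} (hF : Continuous F.uncurry) {C : Set Y} (hC : IsCompact C)
    (hFC : ∀ x, ∀ y ∉ C, F x y = 0) : Continuous fun x => ∫ y, F x y ∂ν := by
  rw [← continuousOn_univ]
  exact continuousOn_integral_of_compact_support hC hF.continuousOn fun x y _ => hFC x y

variable [MeasurableSpace X]

theorem integrable_of_compactlySupported [OpensMeasurableSpace X] (v : C_c(X, E))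
    (μ : Measure X) [IsFiniteMeasureOnCompacts μ] : Integrable v μ :=
  v.continuous.integrable_of_hasCompactSupport v.hasCompactSupport

variable {μ : Measure X}

theorem integral_congr_of_eqOn_support [NormedSpace ℝ E] [μ.Regular] {f g : X → E}
    (h : EqOn f g μ.support) : ∫ t, f t ∂μ = ∫ t, g t ∂μ :=
  integral_congr_ae (mem_of_superset Measure.support_mem_ae_of_regular h)

theorem integral_eq_of_eqOn_support [NormedSpace ℝ E] [CompleteSpace E] [μ.Regular]
    [IsProbabilityMeasure μ] {f : X → E} {c : E} (h : ∀ t ∈ μ.support, f t = c) :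
    ∫ t, f t ∂μ = c := by
  rw [integral_congr_of_eqOn_support (g := fun _ => c) h]
  simp

theorem exists_mem_support_ne_zero_of_integral_ne_zero [NormedSpace ℝ E] [μ.Regular] {f : X → E}
    (h : ∫ t, f t ∂μ ≠ 0) : ∃ t ∈ μ.support, f t ≠ 0 := by
  contrapose! h
  rw [integral_congr_of_eqOn_support (g := fun _ => 0) h, integral_zero]

theorem integral_pos_of_mem_support {f : X → ℝ} (hf : Continuous f) (hf0 : ∀ t, 0 ≤ f t)
    (hfμ : Integrable f μ) {t : X} (ht : t ∈ μ.support) (hft : 0 < f t) : 0 < ∫ t, f t ∂μ := by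
  rw [integral_pos_iff_support_of_nonneg hf0 hfμ]
  exact (Measure.mem_support_iff_forall t).1 ht _ (hf.isOpen_support.mem_nhds hft.ne')

theorem integrable_of_isCompact_support [T2Space X] [OpensMeasurableSpace X] [μ.Regular]
    (hμ : IsCompact μ.support) {f : X → E} (hf : Continuous f) : Integrable f μ := by
  rw [← Measure.restrict_eq_self_of_ae_mem (Measure.support_mem_ae_of_regular (μ := μ))]
  exact hf.continuousOn.integrableOn_compact hμ

variable [T2Space X] [LocallyCompactSpace X] [BorelSpace X] [NormedSpace ℝ E] {Y : Type*}
  [TopologicalSpace Y] [T2Space Y] [LocallyCompactSpace Y] [MeasurableSpace Y] [BorelSpace Y]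
  {ν : Measure Y} [IsFiniteMeasureOnCompacts ν] {C : Set Y}

/- Only the compact sets `supp μ` and `C` contribute to the integrals. The cutoff functions make the
integrand compactly supported, which is what joint measurability requires when `X` and `Y` are not
second countable. -/
theorem integral_integral_swap_smul [CompleteSpace E] [IsFiniteMeasure μ] [μ.Regular]
    (hμ : IsCompact μ.support) {F : X → Y → ℝ} (hF : Continuous F.uncurry)
    (hC : IsCompact C) (hFC : ∀ x ∈ μ.support, ∀ y ∉ C, F x y = 0)
    {φ : Y → E} (hφ : AEStronglyMeasurable φ ν) {M : ℝ} (hφM : ∀ᵐ y ∂ν, ‖φ y‖ ≤ M) :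
    ∫ x, ∫ y, F x y • φ y ∂ν ∂μ = ∫ y, (∫ x, F x y ∂μ) • φ y ∂ν := by
  obtain ⟨a, ha, -, -⟩ := exists_bump hμ isOpen_univ (subset_univ _)
  obtain ⟨b, hb, -, -⟩ := exists_bump hC isOpen_univ (subset_univ _)
  have : Fact (ν C < ⊤) := ⟨hC.measure_lt_top⟩
  let G (x : X) (y : Y) : ℝ := a x * b y * F x y
  have hGF : ∀ x ∈ μ.support, ∀ y ∈ C, G x y = F x y := fun x hx y hy => by
    simp [G, ha hx, hb hy]
  have hG : Continuous fun q : X × Y => G q.1 q.2 :=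
    ((a.continuous.comp continuous_fst).mul (b.continuous.comp continuous_snd)).mul hF
  have hGc : HasCompactSupport fun q : X × Y => G q.1 q.2 := by
    refine .intro (a.hasCompactSupport.isCompact.prod b.hasCompactSupport.isCompact) fun q hq => ?_
    obtain hq | hq := not_and_or.1 hq <;> simp [G, image_eq_zero_of_notMem_tsupport hq]
  have hint : Integrable (Function.uncurry fun x y => G x y • φ y) (μ.prod (ν.restrict C)) := by
    obtain ⟨B, hB⟩ := hG.bounded_above_of_compact_support hGc
    refine Integrable.of_bound ((hGc.stronglyMeasurable_of_prod hG).aestronglyMeasurable.smul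
      (hφ.restrict (s := C)).comp_snd) (B * M) ?_
    filter_upwards [Measure.quasiMeasurePreserving_snd.ae (ae_restrict_of_ae hφM)] with q hq
    rw [Function.uncurry_def, norm_smul]
    exact mul_le_mul (hB q) hq (norm_nonneg _) ((norm_nonneg _).trans (hB q))
  have hFμ : ∀ y ∉ C, ∫ x, F x y ∂μ = 0 := fun y hy =>
    (integral_congr_of_eqOn_support fun x hx => hFC x hx y hy).trans (integral_zero X ℝ)
  calc ∫ x, ∫ y, F x y • φ y ∂ν ∂μ = ∫ x, ∫ y in C, G x y • φ y ∂ν ∂μ := by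
        refine integral_congr_of_eqOn_support fun x hx => ?_
        rw [setIntegral_congr_fun hC.measurableSet fun y hy => by rw [hGF x hx y hy]]
        exact (setIntegral_eq_integral_of_forall_compl_eq_zero
          fun y hy => by rw [hFC x hx y hy, zero_smul]).symm
    _ = ∫ y in C, ∫ x, G x y • φ y ∂μ ∂ν := integral_integral_swap hint
    _ = ∫ y in C, (∫ x, F x y ∂μ) • φ y ∂ν := by
        refine setIntegral_congr_fun hC.measurableSet fun y hy => ?_
        rw [← integral_smul_const]
        exact integral_congr_of_eqOn_support fun x hx => by rw [hGF x hx y hy]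
    _ = ∫ y, (∫ x, F x y ∂μ) • φ y ∂ν :=
        setIntegral_eq_integral_of_forall_compl_eq_zero fun y hy => by simp [hFμ y hy]

end CompactSupport

section Support

theorem support_map_of_isCompact {X Y : Type*} [TopologicalSpace X] [MeasurableSpace X]
    [BorelSpace X] [TopologicalSpace Y] [T2Space Y] [MeasurableSpace Y] [BorelSpace Y]
    {μ : Measure X} [μ.Regular] (hμ : IsCompact μ.support) {p : X → Y} (hp : Continuous p) :
    (μ.map p).support = p '' μ.support := by
  have hcl : IsClosed (p '' μ.support) := (hμ.image hp).isClosed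
  refine Subset.antisymm (Measure.support_subset_of_isClosed hcl ?_) ?_
  · rw [mem_ae_map_iff hp.aemeasurable hcl.measurableSet]
    exact mem_of_superset Measure.support_mem_ae_of_regular (subset_preimage_image p _)
  · rintro _ ⟨x, hx, rfl⟩
    rw [Measure.mem_support_iff_forall] at hx ⊢
    exact fun U hU => (hx _ (hp.continuousAt.preimage_mem_nhds hU)).trans_le
      (Measure.le_map_apply hp.aemeasurable U)

end Support

section RegularMeasure

variable {X : Type*} [TopologicalSpace X] [MeasurableSpace X] {μ : Measure X}

theorem measure_iUnion_of_directed_of_isOpen [OpensMeasurableSpace X] [μ.InnerRegular]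
    {ι : Type*} [Nonempty ι] {U : ι → Set X} (hU : ∀ i, IsOpen (U i)) (hd : Directed (· ⊆ ·) U) :
    μ (⋃ i, U i) = ⨆ i, μ (U i) := by
  refine le_antisymm ?_ (iSup_le fun i => measure_mono (subset_iUnion U i))
  rw [(isOpen_iUnion hU).measurableSet.measure_eq_iSup_isCompact]
  refine iSup₂_le fun C hCU => iSup_le fun hC => ?_
  obtain ⟨i, hi⟩ := hC.elim_directed_cover U hU hCU hd
  exact (measure_mono hi).trans (le_iSup (fun i => μ (U i)) i)

theorem measure_eq_iSup_interior_compacts [OpensMeasurableSpace X] [LocallyCompactSpace X]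
    [μ.InnerRegular] {U : Set X} (hU : IsOpen U) :
    μ U = ⨆ C : {C : TopologicalSpace.Compacts X // (C : Set X) ⊆ U}, μ (interior C.1) := by
  have : Nonempty {C : TopologicalSpace.Compacts X // (C : Set X) ⊆ U} :=
    ⟨⟨⊥, empty_subset U⟩⟩
  rw [← measure_iUnion_of_directed_of_isOpen (fun _ => isOpen_interior) fun C D =>
    ⟨⟨C.1 ⊔ D.1, union_subset C.2 D.2⟩, interior_mono subset_union_left,
      interior_mono subset_union_right⟩]
  congr 1
  refine Subset.antisymm (fun x hx => ?_) (iUnion_subset fun C => interior_subset.trans C.2)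
  obtain ⟨C, hCx, hCU, hC⟩ := local_compact_nhds (hU.mem_nhds hx)
  exact mem_iUnion.2 ⟨⟨⟨C, hC⟩, hCU⟩, mem_interior_iff_mem_nhds.2 hCx⟩

variable [BorelSpace X] {ι : Type*} [SemilatticeSup ι] [Nonempty ι]
  {F : ι → X → ENNReal} (hF : ∀ i, LowerSemicontinuous (F i)) (hmono : Monotone F)

include hF hmono

/- For each rational `q` countably many of the open sets `{q < F i}` exhaust the measure of their
union. -/
theorem exists_monotone_iSup_ae_eq_iSup [IsFiniteMeasure μ] [μ.InnerRegular] :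
    ∃ i : ℕ → ι, Monotone i ∧ ∀ᵐ x ∂μ, ⨆ n, F (i n) x = ⨆ j, F j x := by
  have hopen (r : ENNReal) (j : ι) : IsOpen {x | r < F j x} := (hF j).isOpen_preimage r
  have hsup (r : ENNReal) : μ {x | r < ⨆ j, F j x} = ⨆ j, μ {x | r < F j x} := by
    rw [← measure_iUnion_of_directed_of_isOpen (hopen r) (Monotone.directed_le fun i j hij x hx =>
      lt_of_lt_of_le hx (hmono hij x))]
    simp only [lt_iSup_iff, ofPred_exists]
  choose u _ hu k hk using fun q : ℚ => exists_seq_tendsto_sSup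
    (range_nonempty fun j => μ {x | (Real.toNNReal q : ENNReal) < F j x}) (OrderTop.bddAbove _)
  let e := Denumerable.eqv (ℚ × ℕ)
  let l := partialSups fun n => k (e.symm n).1 (e.symm n).2
  have hkl (q : ℚ) (n : ℕ) : k q n ≤ l (e (q, n)) := by
    simpa [e] using le_partialSups (fun n => k (e.symm n).1 (e.symm n).2) (e (q, n))
  have hle (x : X) : ⨆ n, F (l n) x ≤ ⨆ j, F j x := iSup_le fun n => le_iSup (F · x) (l n)
  refine ⟨l, l.monotone, ?_⟩
  have hq (q : ℚ) : {x | (Real.toNNReal q : ENNReal) < ⨆ n, F (l n) x}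
      =ᵐ[μ] {x | (Real.toNNReal q : ENNReal) < ⨆ j, F j x} := by
    refine ae_eq_of_subset_of_measure_ge (fun x hx => lt_of_lt_of_le hx (hle x)) ?_
      ((lowerSemicontinuous_iSup fun n => hF (l n)).measurable measurableSet_Ioi).nullMeasurableSet
      (measure_ne_top μ _)
    rw [hsup, iSup]
    refine le_of_tendsto' (hu q) fun n => (hk q n).symm.trans_le (measure_mono fun x hx => ?_)
    exact lt_of_lt_of_le hx (le_iSup_of_le (f := fun n => F (l n) x) _ (hmono (hkl q n) x))
  filter_upwards [ae_all_iff.2 fun q => (hq q).mem_iff] with x hx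
  refine le_antisymm (hle x) (not_lt.1 fun hlt => ?_)
  obtain ⟨q, -, hq₁, hq₂⟩ := ENNReal.lt_iff_exists_rat_btwn.1 hlt
  exact hq₁.not_gt ((hx q).2 hq₂)

theorem lintegral_iSup_of_lowerSemicontinuous [IsFiniteMeasure μ] [μ.InnerRegular] :
    ∫⁻ x, ⨆ i, F i x ∂μ = ⨆ i, ∫⁻ x, F i x ∂μ := by
  obtain ⟨i, hi, hae⟩ := exists_monotone_iSup_ae_eq_iSup (μ := μ) hF hmono
  refine le_antisymm ?_ (iSup_le fun j => lintegral_mono fun x => le_iSup (fun j => F j x) j)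
  rw [← lintegral_congr_ae hae, lintegral_iSup (fun n => (hF (i n)).measurable) (hmono.comp hi)]
  exact iSup_le fun n => le_iSup (fun j => ∫⁻ x, F j x ∂μ) (i n)

end RegularMeasure

section Density

variable {X : Type*} [TopologicalSpace X] [MeasurableSpace X] [BorelSpace X]
  {μ : Measure X}

theorem innerRegular_of_absolutelyContinuous [T2Space X] [IsFiniteMeasure μ] [μ.InnerRegular]
    {ρ : Measure X} (h : ρ ≪ μ) : ρ.InnerRegular := by
  refine ⟨fun A hA r hr => ?_⟩
  choose C hCA hC hCμ using fun n : ℕ => hA.exists_isCompact_sdiff_lt (measure_ne_top μ A)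
    (ENNReal.inv_ne_zero.2 (ENNReal.natCast_ne_top n))
  have hnull : μ (A \ ⋃ n, C n) = 0 := nonpos_iff_eq_zero.1 <|
    ge_of_tendsto' ENNReal.tendsto_inv_nat_nhds_zero fun n =>
      (measure_mono (sdiff_subset_sdiff_right (subset_iUnion C n))).trans (hCμ n).le
  rw [← measure_eq_measure_of_null_sdiff (iUnion_subset hCA) (h hnull),
    measure_iUnion_eq_iSup_accumulate, lt_iSup_iff] at hr
  obtain ⟨n, hn⟩ := hr
  exact ⟨accumulate C n, iUnion₂_subset fun i _ => hCA i, isCompact_accumulate hC n, hn⟩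

theorem integral_withDensity_ofReal {E : Type*} [NormedAddCommGroup E] [NormedSpace ℝ E]
    (v : C_c(X, ℝ)) (hv : ∀ x, 0 ≤ v x) (f : X → E) :
    ∫ x, f x ∂μ.withDensity (fun x => ENNReal.ofReal (v x)) = ∫ x, v x • f x ∂μ := by
  simpa only [ENNReal.toReal_ofReal (hv _)] using integral_withDensity_eq_integral_toReal_smul
    (μ := μ) (map_continuous v).measurable.ennreal_ofReal (by simp) f

variable [IsFiniteMeasureOnCompacts μ]

theorem measure_le_ofReal_integral (f : C_c(X, ℝ)) (hf : ∀ x, 0 ≤ f x) {A : Set X}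
    (hA : MeasurableSet A) (hfA : EqOn f 1 A) : μ A ≤ ENNReal.ofReal (∫ x, f x ∂μ) := by
  rw [ofReal_integral_eq_lintegral_ofReal (integrable_of_compactlySupported f μ) (.of_forall hf),
    ← lintegral_indicator_one hA]
  refine lintegral_mono (indicator_le fun x hx => ?_)
  simp [hfA hx]

theorem ofReal_integral_le_measure (f : C_c(X, ℝ)) (hf : ∀ x, f x ∈ Icc 0 1) {U : Set X}
    (hfU : tsupport f ⊆ U) : ENNReal.ofReal (∫ x, f x ∂μ) ≤ μ U := by
  rw [ofReal_integral_eq_lintegral_ofReal (integrable_of_compactlySupported f μ)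
    (.of_forall fun x => (hf x).1)]
  refine le_trans (lintegral_mono fun x => ?_)
    ((lintegral_indicator_one (isClosed_tsupport f).measurableSet).trans_le (measure_mono hfU))
  by_cases hx : x ∈ tsupport f
  · simp [hx, (hf x).2]
  · simp [image_eq_zero_of_notMem_tsupport hx]

variable (v : C_c(X, ℝ))

theorem lintegral_withDensity_ofReal (hv : ∀ x, 0 ≤ v x) {f : X → ℝ} (hf : Continuous f)
    (hf0 : ∀ x, 0 ≤ f x) :
    ∫⁻ x, ENNReal.ofReal (f x) ∂μ.withDensity (fun x => ENNReal.ofReal (v x))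
      = ENNReal.ofReal (∫ x, v x * f x ∂μ) := by
  have hcont := map_continuous v
  rw [lintegral_withDensity_eq_lintegral_mul _ hcont.measurable.ennreal_ofReal
    hf.measurable.ennreal_ofReal, ofReal_integral_eq_lintegral_ofReal (f := fun x => v x * f x)
    ((hcont.mul hf).integrable_of_hasCompactSupport v.hasCompactSupport.mul_right)
    (.of_forall fun x => mul_nonneg (hv x) (hf0 x))]
  simp only [Pi.mul_apply, ENNReal.ofReal_mul (hv _)]

theorem withDensity_ofReal_univ (hv : ∀ x, 0 ≤ v x) :
    μ.withDensity (fun x => ENNReal.ofReal (v x)) univ = ENNReal.ofReal (∫ x, v x ∂μ) := by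
  simpa using lintegral_withDensity_ofReal (μ := μ) v hv continuous_one fun _ => zero_le_one

instance isFiniteMeasure_withDensity_ofReal_compactlySupported :
    IsFiniteMeasure (μ.withDensity fun x => ENNReal.ofReal (v x)) :=
  MeasureTheory.isFiniteMeasure_withDensity_ofReal (integrable_of_compactlySupported v μ).2

theorem innerRegular_withDensity_ofReal [T2Space X] [μ.InnerRegular] :
    (μ.withDensity fun x => ENNReal.ofReal (v x)).InnerRegular := by
  have : Fact (μ (tsupport v) < ⊤) := ⟨v.hasCompactSupport.isCompact.measure_lt_top⟩
  have hv : (tsupport v).indicator (fun x => ENNReal.ofReal (v x))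
      = fun x => ENNReal.ofReal (v x) :=
    indicator_eq_self.2 fun x hx => subset_tsupport v fun h => hx (by simp [h])
  rw [← hv, withDensity_indicator (isClosed_tsupport v).measurableSet]
  exact innerRegular_of_absolutelyContinuous (withDensity_absolutelyContinuous _ _)

end Density

section Kernel

variable {X Y : Type*} [TopologicalSpace X] [MeasurableSpace X] [TopologicalSpace Y]
  [MeasurableSpace Y]

theorem integrable_integral_of_hasCompactSupport [R1Space X] [OpensMeasurableSpace X]
    [OpensMeasurableSpace Y] {μ : Measure X} [IsFiniteMeasureOnCompacts μ] {ν : Measure Y}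
    [IsFiniteMeasureOnCompacts ν] {F : X → Y → ℝ} (hF : Continuous F.uncurry)
    (hFc : HasCompactSupport F.uncurry) : Integrable (fun x => ∫ y, F x y ∂ν) μ := by
  have hzero {x : X} {y : Y} (h : F x y ≠ 0) : (x, y) ∈ tsupport F.uncurry :=
    subset_tsupport F.uncurry h
  have hcont := continuous_integral_of_forall_notMem_eq_zero (ν := ν) hF
    (hFc.isCompact.image continuous_snd)
    fun x y => not_imp_comm.1 fun h => mem_image_of_mem Prod.snd (hzero h)
  refine hcont.integrable_of_hasCompactSupport
    (.intro (hFc.isCompact.image continuous_fst) fun x hx => ?_)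
  exact integral_eq_zero_of_ae (.of_forall fun y =>
    not_imp_comm.1 (fun h => mem_image_of_mem Prod.fst (hzero h)) hx)

theorem mul_integral_le_mul_integral_of_kernel [R1Space X] [BorelSpace X] [R1Space Y]
    [BorelSpace Y] {μ : Measure X} [IsFiniteMeasureOnCompacts μ] {ν : Measure Y}
    [IsFiniteMeasureOnCompacts ν] {F : X → Y → ℝ} (hF : Continuous F.uncurry)
    (hFc : HasCompactSupport F.uncurry) (v : C_c(X, ℝ)) (w : C_c(Y, ℝ)) {a b : ℝ}
    (hw : ∀ y, a * w y ≤ ∫ x, F x y ∂μ) (hv : ∀ x, ∫ y, F x y ∂ν ≤ b * v x) :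
    a * ∫ y, w y ∂ν ≤ b * ∫ x, v x ∂μ := by
  have hFswap : Continuous (Function.uncurry fun y x => F x y) := hF.comp continuous_swap
  have hFcswap : HasCompactSupport (Function.uncurry fun y x => F x y) :=
    hFc.comp_homeomorph (Homeomorph.prodComm Y X)
  calc a * ∫ y, w y ∂ν = ∫ y, a * w y ∂ν := (integral_const_mul _ _).symm
    _ ≤ ∫ y, ∫ x, F x y ∂μ ∂ν :=
        integral_mono ((integrable_of_compactlySupported w ν).const_mul a)
          (integrable_integral_of_hasCompactSupport hFswap hFcswap) hw
    _ = ∫ x, ∫ y, F x y ∂ν ∂μ := (integral_integral_swap_of_hasCompactSupport hF hFc).symm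
    _ ≤ ∫ x, b * v x ∂μ :=
        integral_mono (integrable_integral_of_hasCompactSupport hF hFc)
          ((integrable_of_compactlySupported v μ).const_mul b) hv
    _ = b * ∫ x, v x ∂μ := integral_const_mul _ _

theorem ofReal_le_measure_of_forall_le_integral [T2Space X] [LocallyCompactSpace X] [BorelSpace X]
    {μ : Measure X} [IsFiniteMeasureOnCompacts μ] [μ.InnerRegular] {C : Set X} (hC : IsCompact C)
    {c : ℝ} (hc : ∀ f : C_c(X, ℝ), EqOn f 1 C → (∀ t, f t ∈ Icc 0 1) → c ≤ ∫ t, f t ∂μ) :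
    ENNReal.ofReal c ≤ μ C := by
  refine le_of_forall_gt fun r hr => ?_
  obtain ⟨U, hCU, hU, hUr⟩ := hC.exists_isOpen_lt_of_lt r hr
  obtain ⟨f, hfC, hfU, hf⟩ := exists_bump hC hU hCU
  exact (ENNReal.ofReal_le_ofReal (hc f hfC hf)).trans_lt
    ((ofReal_integral_le_measure f hf hfU).trans_lt hUr)

end Kernel

/-! ### Operators between function spaces and invariant functionals -/

section LpTop

variable {X Y E : Type*} [MeasurableSpace X] [MeasurableSpace Y] [NormedAddCommGroup E]
  {m : Measure X} {m' : Measure Y}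

theorem ae_norm_coeFn_le_norm (f : Lp E ⊤ m) : ∀ᵐ x ∂m, ‖f x‖ ≤ ‖f‖ := by
  rw [Lp.norm_def, toReal_eLpNorm (Lp.aestronglyMeasurable f)]
  exact ae_le_lpNorm_exponent_top (Lp.memLp f)

theorem norm_toLp_top_le {f : X → E} (hf : MemLp f ⊤ m) {C : ℝ} (hC : 0 ≤ C)
    (h : ∀ᵐ x ∂m, ‖f x‖ ≤ C) : ‖hf.toLp f‖ ≤ C := by
  rw [Lp.norm_toLp, eLpNorm_exponent_top]
  exact ENNReal.toReal_le_of_le_ofReal hC (eLpNormEssSup_le_of_ae_bound h)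

theorem norm_integral_smul_le_integral_abs_mul_norm [NormedSpace ℝ E] {w : X → ℝ}
    (hw : Integrable w m) (f : Lp E ⊤ m) :
    ‖∫ x, w x • f x ∂m‖ ≤ (∫ x, |w x| ∂m) * ‖f‖ := by
  rw [← integral_mul_const]
  refine norm_integral_le_of_norm_le (hw.abs.mul_const _) ?_
  filter_upwards [ae_norm_coeFn_le_norm f] with x hx
  rw [norm_smul, Real.norm_eq_abs]
  gcongr

section ToLpTop

variable [TopologicalSpace X] [BorelSpace X] {𝕜 : Type*} [RCLike 𝕜]

/-- The map `C^b(X) → L^∞(X, m)` that sends a function to its class. -/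
def bcfToLpTop (m : Measure X) : (X →ᵇ 𝕜) →L[𝕜] Lp 𝕜 ⊤ m :=
  LinearMap.mkContinuous
    { toFun f := f.memLp_top.toLp f
      map_add' _ _ := rfl
      map_smul' _ _ := rfl }
    1 fun f => by
      rw [one_mul]
      exact norm_toLp_top_le f.memLp_top (norm_nonneg f) (.of_forall f.norm_coe_le_norm)

theorem coeFn_bcfToLpTop (f : X →ᵇ 𝕜) : bcfToLpTop m f =ᵐ[m] f := f.memLp_top.coeFn_toLp

end ToLpTop

section CompLpTop

variable {p : X → Y} (hp : Measure.QuasiMeasurePreserving p m m')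

include hp

theorem memLp_top_comp (f : Lp E ⊤ m') : MemLp (f ∘ p) ⊤ m :=
  memLp_top_of_bound ((Lp.aestronglyMeasurable f).comp_quasiMeasurePreserving hp) ‖f‖
    (hp.ae (ae_norm_coeFn_le_norm f))

/-- Composition with a nonsingular map `p`, as an operator `L^∞(Y) → L^∞(X)`. -/
def compLpTop (𝕜 : Type*) [NormedField 𝕜] [NormedSpace 𝕜 E] : Lp E ⊤ m' →L[𝕜] Lp E ⊤ m :=
  LinearMap.mkContinuous
    { toFun f := (memLp_top_comp hp f).toLp (f ∘ p)
      map_add' f g := MemLp.toLp_congr _ ((memLp_top_comp hp f).add (memLp_top_comp hp g))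
        (hp.ae_eq_comp (Lp.coeFn_add f g))
      map_smul' c f := MemLp.toLp_congr _ ((memLp_top_comp hp f).const_smul c)
        (hp.ae_eq_comp (Lp.coeFn_smul c f)) }
    1 fun f => by
      rw [one_mul]
      exact norm_toLp_top_le (memLp_top_comp hp f) (norm_nonneg f)
        (hp.ae (ae_norm_coeFn_le_norm f))

theorem coeFn_compLpTop (𝕜 : Type*) [NormedField 𝕜] [NormedSpace 𝕜 E] (f : Lp E ⊤ m') :
    compLpTop hp 𝕜 f =ᵐ[m] f ∘ p :=
  (memLp_top_comp hp f).coeFn_toLp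

end CompLpTop

end LpTop

section Descent

variable {X Y 𝕜 E F : Type*} [TopologicalSpace X] [TopologicalSpace Y]
  [NontriviallyNormedField 𝕜]
  [SeminormedAddCommGroup E] [NormedSpace 𝕜 E] [NormedAddCommGroup F] [NormedSpace 𝕜 F]

theorem exists_clm_forall_apply_eq_of_isQuotientMap {p : X → Y} (hp : IsQuotientMap p)
    (L : E →L[𝕜] X →ᵇ F) (hL : ∀ f x y, p x = p y → L f x = L f y) :
    ∃ D : E →L[𝕜] Y →ᵇ F, ∀ f x, D f (p x) = L f x := by
  let D (f : E) (y : Y) : F := L f (Function.surjInv hp.surjective y)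
  have hD (f : E) (x : X) : D f (p x) = L f x := hL f _ _ (Function.surjInv_eq hp.surjective _)
  have hbound (f : E) (y : Y) : ‖D f y‖ ≤ ‖L‖ * ‖f‖ :=
    ((L f).norm_coe_le_norm _).trans (L.le_opNorm f)
  have hcont (f : E) : Continuous (D f) :=
    hp.continuous_iff.2 ((L f).continuous.congr fun x => (hD f x).symm)
  exact ⟨LinearMap.mkContinuous
    { toFun f := .ofNormedAddCommGroup (D f) (hcont f) _ (hbound f)
      map_add' f g := BoundedContinuousFunction.ext fun y => by simp [D]
      map_smul' c f := BoundedContinuousFunction.ext fun y => by simp [D] }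
    ‖L‖ fun f => BoundedContinuousFunction.norm_ofNormedAddCommGroup_le _ (by positivity)
      (hbound f), hD⟩

end Descent

section InvariantFunctional

variable {𝕜 E : Type*} [RCLike 𝕜] [NormedAddCommGroup E] [NormedSpace 𝕜 E]

variable (𝕜) in
/-- The monoid of the linear contractions that fix `v`. -/
def contractionsFixing (v : E) : Submonoid (E →L[𝕜] E) where
  carrier := {A | ‖A‖ ≤ 1 ∧ A v = v}
  one_mem' := ⟨ContinuousLinearMap.norm_id_le, rfl⟩
  mul_mem' hA hB := ⟨(norm_mul_le _ _).trans (mul_le_one₀ hA.1 (norm_nonneg _) hB.1), by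
    rw [mul_apply_eq_comp, hB.2, hA.2]⟩

theorem norm_apply_le_of_mem_contractionsFixing {v : E} {A : E →L[𝕜] E}
    (hA : A ∈ contractionsFixing 𝕜 v) (φ : E) : ‖A φ‖ ≤ ‖φ‖ :=
  (A.le_of_opNorm_le hA.1 φ).trans_eq (one_mul _)

theorem inv_smul_sum_pow_mem_contractionsFixing {v : E} {T : E →L[𝕜] E}
    (hT : T ∈ contractionsFixing 𝕜 v) {n : ℕ} (hn : n ≠ 0) :
    (n : 𝕜)⁻¹ • ∑ i ∈ Finset.range n, T ^ i ∈ contractionsFixing 𝕜 v := by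
  have hn' : (n : 𝕜) ≠ 0 := Nat.cast_ne_zero.2 hn
  constructor
  · rw [norm_smul, norm_inv, RCLike.norm_natCast, inv_mul_le_iff₀ (by positivity)]
    calc ‖∑ i ∈ Finset.range n, T ^ i‖ ≤ ∑ i ∈ Finset.range n, 1 :=
          norm_sum_le_of_le _ fun i _ => (pow_mem hT i).1
      _ = n * 1 := by simp
  · simp only [smul_apply, sum_apply, (pow_mem hT _).2, Finset.sum_const, Finset.card_range]
    rw [← Nat.cast_smul_eq_nsmul 𝕜, inv_smul_smul₀ hn']

theorem norm_inv_smul_sum_pow_apply_sub_le {v : E} {T : E →L[𝕜] E}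
    (hT : T ∈ contractionsFixing 𝕜 v) (φ : E) (n : ℕ) :
    ‖((n : 𝕜)⁻¹ • ∑ i ∈ Finset.range n, T ^ i) (φ - T φ)‖ ≤ 2 * ‖φ‖ / n := by
  have htele : (∑ i ∈ Finset.range n, T ^ i) (φ - T φ) = φ - (T ^ n) φ := by
    simpa using congrArg (fun A : E →L[𝕜] E => A φ) (geom_sum_mul_neg T n)
  have hle : ‖φ - (T ^ n) φ‖ ≤ 2 * ‖φ‖ := by
    linarith [norm_sub_le φ ((T ^ n) φ),
      norm_apply_le_of_mem_contractionsFixing (pow_mem hT n) φ]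
  rw [smul_apply, htele, norm_smul, norm_inv, RCLike.norm_natCast, inv_mul_eq_div]
  gcongr

/-- The span of the vectors `φ - T φ` with `T` in `𝒯`. The functionals that vanish on it are
those invariant under `𝒯`. -/
def coboundaries (𝒯 : Set (E →L[𝕜] E)) : Submodule 𝕜 E :=
  Submodule.span 𝕜 {w | ∃ T ∈ 𝒯, ∃ φ, w = φ - T φ}

theorem exists_norm_apply_le_of_mem_coboundaries {𝒯 : Set (E →L[𝕜] E)} {v : E}
    (hcomm : ∀ T ∈ 𝒯, ∀ T' ∈ 𝒯, Commute T T') (h𝒯 : 𝒯 ⊆ contractionsFixing 𝕜 v) {w : E}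
    (hw : w ∈ coboundaries 𝒯) {ε : ℝ} (hε : 0 < ε) :
    ∃ A ∈ Algebra.adjoin 𝕜 𝒯, A ∈ contractionsFixing 𝕜 v ∧ ‖A w‖ ≤ ε := by
  induction hw using Submodule.span_induction generalizing ε with
  | mem w hw =>
    obtain ⟨T, hT, φ, rfl⟩ := hw
    obtain ⟨n, hn⟩ := exists_nat_gt (2 * ‖φ‖ / ε)
    have hn0 : (0 : ℝ) < n := lt_of_le_of_lt (by positivity) hn
    refine ⟨(n : 𝕜)⁻¹ • ∑ i ∈ Finset.range n, T ^ i, ?_,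
      inv_smul_sum_pow_mem_contractionsFixing (h𝒯 hT) (by exact_mod_cast hn0.ne'), ?_⟩
    · exact Subalgebra.smul_mem _ (Subalgebra.sum_mem _ fun i _ =>
        Subalgebra.pow_mem _ (Algebra.subset_adjoin hT) i) _
    · refine (norm_inv_smul_sum_pow_apply_sub_le (h𝒯 hT) φ n).trans ?_
      exact (div_le_comm₀ hn0 hε).2 hn.le
  | zero => exact ⟨1, one_mem _, one_mem _, by simpa using hε.le⟩
  | add w₁ w₂ _ _ ih₁ ih₂ =>
    obtain ⟨A, hA, hAv, hAw⟩ := ih₁ (half_pos hε)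
    obtain ⟨B, hB, hBv, hBw⟩ := ih₂ (half_pos hε)
    have hAB : A * B = B * A := Algebra.commute_of_mem_adjoin_of_forall_mem_commute hB fun T hT =>
      (Algebra.commute_of_mem_adjoin_of_forall_mem_commute hA fun T' hT' => hcomm T hT T' hT').symm
    refine ⟨A * B, mul_mem hA hB, mul_mem hAv hBv, ?_⟩
    calc ‖(A * B) (w₁ + w₂)‖ = ‖B (A w₁) + A (B w₂)‖ := by
          rw [map_add, mul_apply_eq_comp A B w₂, hAB, mul_apply_eq_comp]
      _ ≤ ‖A w₁‖ + ‖B w₂‖ := norm_add_le_of_le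
          (norm_apply_le_of_mem_contractionsFixing hBv _)
          (norm_apply_le_of_mem_contractionsFixing hAv _)
      _ ≤ ε := by linarith
  | smul c w _ ih =>
    obtain ⟨A, hA, hAv, hAw⟩ := ih (ε := ε / (‖c‖ + 1)) (by positivity)
    refine ⟨A, hA, hAv, ?_⟩
    calc ‖A (c • w)‖ = ‖c‖ * ‖A w‖ := by rw [map_smul, norm_smul]
      _ ≤ (‖c‖ + 1) * (ε / (‖c‖ + 1)) := by gcongr; linarith
      _ = ε := mul_div_cancel₀ _ (by positivity)

theorem norm_le_norm_add_of_mem_coboundaries {𝒯 : Set (E →L[𝕜] E)} {v : E}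
    (hcomm : ∀ T ∈ 𝒯, ∀ T' ∈ 𝒯, Commute T T') (h𝒯 : 𝒯 ⊆ contractionsFixing 𝕜 v) {w : E}
    (hw : w ∈ coboundaries 𝒯) : ‖v‖ ≤ ‖v + w‖ := by
  refine le_of_forall_pos_le_add fun ε hε => ?_
  obtain ⟨A, -, hAv, hAw⟩ := exists_norm_apply_le_of_mem_coboundaries hcomm h𝒯 hw hε
  calc ‖v‖ = ‖A (v + w) - A w‖ := by rw [map_add, hAv.2, add_sub_cancel_right]
    _ ≤ ‖v + w‖ + ε :=
      norm_sub_le_of_le (norm_apply_le_of_mem_contractionsFixing hAv _) hAw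

theorem exists_invariant_functional {𝒯 : Set (E →L[𝕜] E)} {v : E}
    (hcomm : ∀ T ∈ 𝒯, ∀ T' ∈ 𝒯, Commute T T') (h𝒯 : 𝒯 ⊆ contractionsFixing 𝕜 v)
    (hv : v ≠ 0) : ∃ μ : E →L[𝕜] 𝕜, μ v = 1 ∧ ∀ T ∈ 𝒯, ∀ φ, μ (T φ) = μ φ := by
  set N := coboundaries 𝒯
  have hquot : 0 < ‖N.mkQL v‖ := by
    refine (norm_pos_iff.2 hv).trans_le (le_of_forall_gt fun r hr => ?_)
    obtain ⟨u, hu, hur⟩ := QuotientAddGroup.norm_lt_iff.1 hr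
    have hmem : u - v ∈ N := (Submodule.Quotient.eq N).1 hu
    have := norm_le_norm_add_of_mem_coboundaries hcomm h𝒯 hmem
    rw [add_sub_cancel] at this
    exact this.trans_lt hur
  obtain ⟨g, -, hg⟩ := exists_dual_vector 𝕜 (N.mkQL v) hquot.ne'
  have hg0 : g (N.mkQL v) ≠ 0 := by
    rw [hg]
    exact_mod_cast hquot.ne'
  refine ⟨(g (N.mkQL v))⁻¹ • g.comp N.mkQL, inv_mul_cancel₀ hg0, fun T hT φ => ?_⟩
  have : N.mkQL (T φ) = N.mkQL φ :=
    ((Submodule.Quotient.eq N).2 (Submodule.subset_span ⟨T, hT, φ, rfl⟩)).symm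
  simp only [smul_apply, ContinuousLinearMap.comp_apply, this]

end InvariantFunctional

/-! ### Convolution data -/

namespace ConvData

section Translation

variable {K E : Type*} [MeasurableSpace K] [NormedAddCommGroup E] [NormedSpace ℝ E]

/-- The translate `T_x f (y) = ∫ f dω(x, y)` of a function with values in a normed space; for
complex functions this is `ConvData.translate`. -/
def shift (S : ConvData K) (x : K) (f : K → E) (y : K) : E := ∫ t, f t ∂S.conv x y

/-- The function `x ↦ ∫ T_{x~} v(y) f(y) dm(y)`, which equals `x ↦ ∫ v T_x f dm` if `m` is a Haar
measure. For a kernel `v ∈ C_c(K)` it regularizes the function `f`. -/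
def smear (S : ConvData K) (m : Measure K) (v : K → ℝ) (f : K → E) (x : K) : E :=
  ∫ y, S.shift (S.inv x) v y • f y ∂m

theorem shift_nonneg (S : ConvData K) {f : K → ℝ} (hf : ∀ t, 0 ≤ f t) (x y : K) :
    0 ≤ S.shift x f y :=
  integral_nonneg hf

theorem mem_setMul [TopologicalSpace K] {S : ConvData K} {A B : Set K} {z : K} :
    z ∈ S.setMul A B ↔ ∃ a ∈ A, ∃ b ∈ B, z ∈ (S.conv a b).support := by
  simp [setMul]

theorem IsHaar.integral_shift [TopologicalSpace K] {S : ConvData K} {m : Measure K}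
    (hm : S.IsHaar m) (x : K) (v : C_c(K, ℝ)) : ∫ y, S.shift x v y ∂m = ∫ y, v y ∂m := by
  have h := hm.integral_translate x (fun t => (v t : ℂ))
    (Complex.continuous_ofReal.comp v.continuous)
    (v.hasCompactSupport.comp_left Complex.ofReal_zero)
  simp only [ConvData.translate, integral_complex_ofReal] at h
  exact_mod_cast h

end Translation

section Coset

variable {K : Type*} [TopologicalSpace K] [MeasurableSpace K] {S : ConvData K} {H : Set K}

theorem mem_coset {x y : K} : x ∈ S.coset H y ↔ ∃ h ∈ H, x ∈ (S.conv y h).support := by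
  simp [coset, mem_setMul]

namespace IsSubhypergroup

variable (hH : S.IsSubhypergroup H)

include hH

theorem inv_mem {h : K} (hh : h ∈ H) : S.inv h ∈ H :=
  hH.inv_eq ▸ mem_image_of_mem _ hh

theorem mem_of_mem_support {h k z : K} (hh : h ∈ H) (hk : k ∈ H)
    (hz : z ∈ (S.conv h k).support) : z ∈ H :=
  hH.mul_eq ▸ mem_setMul.2 ⟨h, hh, k, hk, hz⟩

end IsSubhypergroup

theorem isSubhypergroup_of_isSubgroup_or_isCompact
    (hH : S.IsSubgroup H ∨ (S.IsSubhypergroup H ∧ IsCompact H)) : S.IsSubhypergroup H :=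
  hH.elim (·.toIsSubhypergroup) (·.1)

end Coset

theorem IsAmenable.of_intertwining {K K' : Type*} [TopologicalSpace K]
    [MeasurableSpace K] [BorelSpace K] [TopologicalSpace K'] [MeasurableSpace K'] [BorelSpace K']
    {S : ConvData K} {S' : ConvData K'} {m : Measure K} {m' : Measure K'} {α : K →ᵇ ℂ}
    {β : K' →ᵇ ℂ} (h : S'.IsAmenable m' β) (D : Lp ℂ ⊤ m →L[ℂ] Lp ℂ ⊤ m')
    (hDα : D (bcfToLpTop m α) = bcfToLpTop m' β)
    (hD : ∀ x, ∃ y, β y = α x ∧ ∀ f g : Lp ℂ ⊤ m,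
      g =ᵐ[m] S.shift x f → D g =ᵐ[m'] S'.shift y (D f)) : S.IsAmenable m α := by
  obtain ⟨M, hMβ, hM⟩ := h
  refine ⟨M.comp D, (congrArg M hDα).trans hMβ, fun x f g hg => ?_⟩
  obtain ⟨y, hy, hDy⟩ := hD x
  exact hy ▸ hM y (D f) (D g) (hDy f g hg)

end ConvData

namespace IsCommHypergroup

variable {K : Type*} [TopologicalSpace K] [T2Space K] [LocallyCompactSpace K]
  [MeasurableSpace K] [BorelSpace K] {S : ConvData K} (hS : IsCommHypergroup S)

include hS

/-! ### Translation operators -/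

section Support

theorem isOpen_support_subset {U : Set K} (hU : IsOpen U) :
    IsOpen {q : K × K | (S.conv q.1 q.2).support ⊆ U} :=
  (TopologicalSpace.vietoris.continuous_iff.1 hS.continuous_support).1 U hU

theorem isOpen_support_inter {U : Set K} (hU : IsOpen U) :
    IsOpen {q : K × K | ((S.conv q.1 q.2).support ∩ U).Nonempty} :=
  (@Continuous.isOpen_preimage _ _ _ (TopologicalSpace.vietoris K) _ hS.continuous_support _
    (TopologicalSpace.vietoris.isOpen_inter_nonempty_of_isOpen hU) :)

theorem support_mem_ae (x y : K) : (S.conv x y).support ∈ ae (S.conv x y) :=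
  have := hS.regular x y
  Measure.support_mem_ae_of_regular

theorem support_nonempty (x y : K) : (S.conv x y).support.Nonempty := by
  have := hS.isProbability x y
  exact Filter.nonempty_of_mem (hS.support_mem_ae x y)

theorem support_one_conv (x : K) : (S.conv S.one x).support = {x} := by
  refine (hS.support_nonempty S.one x).subset_singleton_iff.1
    (Measure.support_subset_of_isClosed isClosed_singleton ?_)
  rw [hS.one_conv]
  exact mem_ae_dirac_iff (measurableSet_singleton x) |>.2 rfl

theorem support_conv_one (x : K) : (S.conv x S.one).support = {x} := by
  rw [hS.comm, hS.support_one_conv]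

theorem inv_one : S.inv S.one = S.one :=
  ((hS.one_mem_support _ _).1 (hS.support_one_conv S.one ▸ mem_singleton _)).symm

/-- The involution as a homeomorphism. -/
def invHomeomorph : K ≃ₜ K where
  toFun := S.inv
  invFun := S.inv
  left_inv := hS.inv_inv
  right_inv := hS.inv_inv
  continuous_toFun := hS.continuous_inv
  continuous_invFun := hS.continuous_inv

theorem isCompact_setMul {A B : Set K} (hA : IsCompact A) (hB : IsCompact B) :
    IsCompact (S.setMul A B) := by
  let s (q : K × K) : TopologicalSpace.Compacts K := ⟨_, hS.isCompact_support q.1 q.2⟩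
  have hs : Continuous s :=
    letI := TopologicalSpace.vietoris K
    TopologicalSpace.Compacts.isEmbedding_coe.continuous_iff.2 hS.continuous_support
  convert TopologicalSpace.Compacts.isCompact_biUnion_coe_of_isCompact
    ((hA.prod hB).image hs) using 1
  ext z
  simp [ConvData.mem_setMul, s, and_assoc]

theorem inv_mem_support {x y z : K} (h : z ∈ (S.conv x y).support) :
    S.inv z ∈ (S.conv (S.inv x) (S.inv y)).support := by
  rw [hS.comm, ← hS.map_inv]
  rw [Measure.mem_support_iff_forall] at h ⊢
  exact fun U hU => (h _ (hS.continuous_inv.continuousAt.preimage_mem_nhds hU)).trans_le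
    (Measure.le_map_apply hS.continuous_inv.aemeasurable U)

end Support

section Shift

variable {E : Type*} [NormedAddCommGroup E]

theorem integrable_conv {f : K → E} (hf : Continuous f) (x y : K) :
    Integrable f (S.conv x y) := by
  have := hS.isProbability x y
  have := hS.regular x y
  exact integrable_of_isCompact_support (hS.isCompact_support x y) hf

variable [NormedSpace ℝ E]

theorem shift_congr {f g : K → E} {x y : K} (h : EqOn f g (S.conv x y).support) :
    S.shift x f y = S.shift x g y :=
  have := hS.regular x y
  integral_congr_of_eqOn_support h

theorem shift_eq_of_forall_mem_support [CompleteSpace E] {f : K → E} {x y : K} {c : E}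
    (h : ∀ t ∈ (S.conv x y).support, f t = c) : S.shift x f y = c :=
  have := hS.regular x y
  have := hS.isProbability x y
  integral_eq_of_eqOn_support h

theorem norm_shift_le {f : K → E} {C : ℝ} (hf : ∀ t, ‖f t‖ ≤ C) (x y : K) :
    ‖S.shift x f y‖ ≤ C := by
  have := hS.isProbability x y
  exact (norm_integral_le_of_norm_le_const (.of_forall hf)).trans (by simp)

theorem exists_mem_support_of_shift_ne_zero {f : K → E} {x y : K} (h : S.shift x f y ≠ 0) :
    ∃ t ∈ (S.conv x y).support, f t ≠ 0 :=
  have := hS.regular x y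
  exists_mem_support_ne_zero_of_integral_ne_zero h

theorem shift_pos_of_mem_support {f : K → ℝ} (hf : Continuous f) (hf0 : ∀ t, 0 ≤ f t)
    {x y t : K} (ht : t ∈ (S.conv x y).support) (hft : 0 < f t) : 0 < S.shift x f y :=
  integral_pos_of_mem_support hf hf0 (hS.integrable_conv hf x y) ht hft

theorem shift_swap (f : K → E) (x y : K) : S.shift x f y = S.shift y f x := by
  rw [ConvData.shift, ConvData.shift, hS.comm]

theorem shift_one [CompleteSpace E] (f : K → E) (y : K) : S.shift S.one f y = f y := by
  rw [ConvData.shift, hS.one_conv, integral_dirac]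

theorem shift_comp_inv (f : K → E) (x y : K) :
    S.shift x (f ∘ S.inv) y = S.shift (S.inv x) f (S.inv y) := by
  rw [ConvData.shift, ConvData.shift, hS.comm (S.inv x), ← hS.map_inv]
  exact (hS.invHomeomorph.measurableEmbedding.integral_map f).symm

end Shift

section RCLike

variable {𝕜 : Type*} [RCLike 𝕜]

theorem re_shift {f : K → 𝕜} (hf : Continuous f) (x y : K) :
    RCLike.re (S.shift x f y) = S.shift x (fun t => RCLike.re (f t)) y :=
  (integral_re (hS.integrable_conv hf x y)).symm

theorem im_shift {f : K → 𝕜} (hf : Continuous f) (x y : K) :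
    RCLike.im (S.shift x f y) = S.shift x (fun t => RCLike.im (f t)) y :=
  (integral_im (hS.integrable_conv hf x y)).symm

variable {F : Type*} [FunLike F K 𝕜] [BoundedContinuousMapClass F K 𝕜]

theorem continuous_shift_uncurry (f : F) : Continuous fun q : K × K => S.shift q.1 f q.2 := by
  have hre := hS.continuous_conv ((f : K →ᵇ 𝕜).comp _ (RCLike.reCLM (K := 𝕜)).lipschitz)
  have him := hS.continuous_conv ((f : K →ᵇ 𝕜).comp _ (RCLike.imCLM (K := 𝕜)).lipschitz)
  refine ((RCLike.continuous_ofReal.comp hre).add ((RCLike.continuous_ofReal.comp him).mul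
    (continuous_const (y := (RCLike.I : 𝕜))))).congr fun q => ?_
  exact integral_re_add_im (hS.integrable_conv (map_continuous f) q.1 q.2)

theorem continuous_shift (x : K) (f : F) : Continuous (S.shift x f) :=
  (hS.continuous_shift_uncurry f).comp (Continuous.prodMk_right x)

theorem shift_shift_rotate (f : F) (x y z : K) :
    S.shift x (S.shift y f) z = S.shift z (S.shift x f) y := by
  have assoc_real (g : K →ᵇ ℝ) : S.shift x (S.shift y g) z = S.shift z (S.shift x g) y := by
    simp only [funext (hS.shift_swap g y)]
    exact hS.assoc g x z y
  have hf := map_continuous f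
  refine RCLike.ext ?_ ?_
  · simp only [hS.re_shift (hS.continuous_shift _ f), hS.re_shift hf]
    exact assoc_real ((f : K →ᵇ 𝕜).comp _ (RCLike.reCLM (K := 𝕜)).lipschitz)
  · simp only [hS.im_shift (hS.continuous_shift _ f), hS.im_shift hf]
    exact assoc_real ((f : K →ᵇ 𝕜).comp _ (RCLike.imCLM (K := 𝕜)).lipschitz)

theorem shift_shift_comm (f : F) (x y z : K) :
    S.shift x (S.shift y f) z = S.shift y (S.shift x f) z := by
  rw [hS.shift_shift_rotate, hS.shift_swap]

theorem shift_shift_right_comm (f : F) (x y z : K) :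
    S.shift x (S.shift y f) z = S.shift x (S.shift z f) y := by
  rw [hS.shift_shift_comm, hS.shift_shift_rotate, hS.shift_shift_rotate]

theorem shift_shift (f : F) (x y z : K) :
    S.shift x (S.shift y f) z = ∫ w, S.shift w f z ∂S.conv x y := by
  rw [hS.shift_shift_right_comm, ConvData.shift]
  simp only [hS.shift_swap f z]

variable (𝕜) in
/-- The translation `f ↦ T_x f` as an operator on `C^b(K)`. -/
def shiftCLM (x : K) : (K →ᵇ 𝕜) →L[𝕜] (K →ᵇ 𝕜) :=
  LinearMap.mkContinuous
    { toFun f := .ofNormedAddCommGroup (S.shift x f) (hS.continuous_shift x f) ‖f‖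
        fun y => hS.norm_shift_le f.norm_coe_le_norm x y
      map_add' f g := BoundedContinuousFunction.ext fun y =>
        integral_add (hS.integrable_conv f.continuous x y) (hS.integrable_conv g.continuous x y)
      map_smul' c f := BoundedContinuousFunction.ext fun y => integral_const_mul c _ }
    1 fun f => by
      rw [one_mul]
      exact BoundedContinuousFunction.norm_ofNormedAddCommGroup_le _ (norm_nonneg f)
        fun y => hS.norm_shift_le f.norm_coe_le_norm x y

@[simp]
theorem coe_shiftCLM (x : K) (f : K →ᵇ 𝕜) : ⇑(hS.shiftCLM 𝕜 x f) = S.shift x f := rfl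

theorem norm_shiftCLM_le (x : K) : ‖hS.shiftCLM 𝕜 x‖ ≤ 1 :=
  LinearMap.mkContinuous_norm_le _ zero_le_one _

theorem commute_shiftCLM (x y : K) : Commute (hS.shiftCLM 𝕜 x) (hS.shiftCLM 𝕜 y) :=
  ContinuousLinearMap.ext fun f => BoundedContinuousFunction.ext (hS.shift_shift_comm f x y)

end RCLike

section SupportAssociativity

theorem exists_mem_support_of_mem_support_conv {x y z t u : K} (hu : u ∈ (S.conv x y).support)
    (ht : t ∈ (S.conv u z).support) :
    ∃ w ∈ (S.conv y z).support, t ∈ (S.conv x w).support := by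
  have hcl : IsClosed (S.setMul {x} (S.conv y z).support) :=
    (hS.isCompact_setMul isCompact_singleton (hS.isCompact_support y z)).isClosed
  suffices t ∈ S.setMul {x} (S.conv y z).support by simpa [ConvData.setMul] using this
  by_contra hnot
  obtain ⟨v, hv1, hvs, hv⟩ := exists_bump isCompact_singleton hcl.isOpen_compl
    (singleton_subset_iff.2 hnot)
  have hv0 : ∀ s, 0 ≤ v s := fun s => (hv s).1
  have hpos : 0 < S.shift x (S.shift z v) y := by
    refine hS.shift_pos_of_mem_support (hS.continuous_shift z v) (S.shift_nonneg hv0 z) hu ?_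
    rw [hS.shift_swap]
    exact hS.shift_pos_of_mem_support v.continuous hv0 ht (by simp [hv1 rfl])
  rw [hS.shift_shift_rotate] at hpos
  obtain ⟨w, hw, hw'⟩ := hS.exists_mem_support_of_shift_ne_zero hpos.ne'
  obtain ⟨s, hs, hs'⟩ := hS.exists_mem_support_of_shift_ne_zero hw'
  exact hvs (subset_tsupport _ hs')
    (ConvData.mem_setMul.2 ⟨x, rfl, w, (hS.comm y z ▸ hw), hs⟩)

theorem mem_support_conv_inv {x y z : K} (h : z ∈ (S.conv x y).support) :
    x ∈ (S.conv z (S.inv y)).support := by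
  obtain ⟨w, hw, hw'⟩ := hS.exists_mem_support_of_mem_support_conv h
    ((hS.one_mem_support z (S.inv z)).2 (hS.inv_inv z).symm)
  have hxw := (hS.one_mem_support _ _).1 hw'
  have := hS.inv_mem_support hw
  rwa [← hxw, hS.inv_inv, hS.comm] at this

theorem mem_support_conv_inv_iff {x y z : K} :
    x ∈ (S.conv z (S.inv y)).support ↔ z ∈ (S.conv x y).support :=
  ⟨fun h => by simpa only [hS.inv_inv] using hS.mem_support_conv_inv h, hS.mem_support_conv_inv⟩

theorem mem_support_inv_conv {x y z : K} (h : z ∈ (S.conv x y).support) :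
    y ∈ (S.conv (S.inv x) z).support := by
  rw [hS.comm] at h ⊢
  exact hS.mem_support_conv_inv h

theorem mem_setMul_of_shift_ne_zero {E : Type*} [NormedAddCommGroup E] [NormedSpace ℝ E]
    {f : K → E} {x y : K} (h : S.shift x f y ≠ 0) : y ∈ S.setMul {S.inv x} (tsupport f) := by
  obtain ⟨t, ht, hft⟩ := hS.exists_mem_support_of_shift_ne_zero h
  exact ConvData.mem_setMul.2
    ⟨S.inv x, rfl, t, subset_tsupport _ hft, hS.mem_support_inv_conv ht⟩

end SupportAssociativity

/-- The translation `f ↦ T_x f` on `C_c(K)`. -/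
def shiftCc (x : K) (v : C_c(K, ℝ)) : C_c(K, ℝ) where
  toFun := S.shift x v
  continuous_toFun := hS.continuous_shift x v
  hasCompactSupport' := .intro (hS.isCompact_setMul isCompact_singleton v.hasCompactSupport)
    fun _ hy => not_imp_comm.1 hS.mem_setMul_of_shift_ne_zero hy

theorem continuous_shift_inv_uncurry (v : C_c(K, ℝ)) :
    Continuous fun q : K × K => S.shift (S.inv q.1) v q.2 :=
  (hS.continuous_shift_uncurry v).comp
    ((hS.continuous_inv.comp continuous_fst).prodMk continuous_snd)

theorem integral_shift_inv_conv (v : C_c(K, ℝ)) (x y z : K) :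
    ∫ w, S.shift (S.inv w) v z ∂S.conv x y
      = S.shift (S.inv x) (S.shift (S.inv y) v) z := by
  rw [hS.shift_shift]
  exact hS.shift_comp_inv (fun w => S.shift w v z) x y

section Smear

variable {E : Type*} [NormedAddCommGroup E] [NormedSpace ℝ E] {m : Measure K}
  [IsFiniteMeasureOnCompacts m]

theorem shift_smear [CompleteSpace E] (v : C_c(K, ℝ)) {f : K → E} (hf : AEStronglyMeasurable f m)
    {M : ℝ} (hfM : ∀ᵐ y ∂m, ‖f y‖ ≤ M) (z x : K) :
    S.shift z (S.smear m v f) x = S.smear m (S.shift (S.inv z) v) f x := by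
  have := hS.isProbability z x
  have := hS.regular z x
  have hzero : ∀ w ∈ (S.conv z x).support,
      ∀ y ∉ S.setMul (S.conv z x).support (tsupport v), S.shift (S.inv w) v y = 0 := by
    refine fun w hw y => not_imp_comm.1 fun hy => ?_
    obtain ⟨_, rfl, t, ht, hyt⟩ := ConvData.mem_setMul.1 (hS.mem_setMul_of_shift_ne_zero hy)
    exact ConvData.mem_setMul.2 ⟨w, hw, t, ht, hS.inv_inv w ▸ hyt⟩
  refine (integral_integral_swap_smul (hS.isCompact_support z x)
    (hS.continuous_shift_inv_uncurry v)
    (hS.isCompact_setMul (hS.isCompact_support z x) v.hasCompactSupport) hzero hf hfM).trans ?_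
  simp only [hS.integral_shift_inv_conv, hS.shift_shift_comm v (S.inv z), ConvData.smear]

theorem continuous_smear (v g : C_c(K, ℝ)) : Continuous (S.smear m v g) := by
  refine continuous_integral_of_forall_notMem_eq_zero
    (F := fun x y => S.shift (S.inv x) v y • g y)
    ((hS.continuous_shift_inv_uncurry v).smul (g.continuous.comp continuous_snd))
    g.hasCompactSupport fun x y hy => ?_
  rw [image_eq_zero_of_notMem_tsupport hy, smul_zero]

theorem shift_smear_of_compactlySupported (v g : C_c(K, ℝ)) (z x : K) :
    S.shift z (S.smear m v g) x = S.smear m (S.shift (S.inv z) v) g x :=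
  hS.shift_smear v (map_continuous g).aestronglyMeasurable
    (.of_forall (g : K →ᵇ ℝ).norm_coe_le_norm) z x

theorem continuous_shift_smear (v g : C_c(K, ℝ)) (x : K) :
    Continuous (S.shift x (S.smear m v g)) :=
  (hS.continuous_smear (m := m) (hS.shiftCc (S.inv x) v) g).congr fun y =>
    (hS.shift_smear_of_compactlySupported v g x y).symm

end Smear

/-! ### Haar measures -/

section Haar

variable {m : Measure K} (hm : S.IsHaar m)

include hm

theorem isOpenPosMeasure : m.IsOpenPosMeasure := by
  have := hm.innerRegular
  have := hm.finiteOnCompacts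
  have : NeZero m := ⟨hm.ne_zero⟩
  obtain ⟨b, hb⟩ := Filter.nonempty_of_mem (Measure.support_mem_ae_of_innerRegular (μ := m))
  refine ⟨fun U hU ⟨a, ha⟩ hmU => ?_⟩
  obtain ⟨v, hva, hvU, hv⟩ := exists_bump isCompact_singleton hU (singleton_subset_iff.2 ha)
  obtain ⟨x, hx⟩ := hS.support_nonempty a (S.inv b)
  have hv_ae : v =ᵐ[m] 0 := by
    filter_upwards [measure_eq_zero_iff_ae_notMem.1 hmU] with y hy
    exact image_eq_zero_of_notMem_tsupport fun h => hy (hvU h)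
  have hv0 : ∀ t, 0 ≤ v t := fun t => (hv t).1
  have hTv : 0 < S.shift x v b :=
    hS.shift_pos_of_mem_support v.continuous hv0 (hS.mem_support_conv_inv_iff.1 hx)
      (by simp [hva rfl])
  have hpos : 0 < ∫ y, S.shift x v y ∂m :=
    integral_pos_of_mem_support (hS.continuous_shift x v) (S.shift_nonneg hv0 x)
      (integrable_of_compactlySupported (hS.shiftCc x v) m) hb hTv
  rw [hm.integral_shift, integral_congr_ae hv_ae] at hpos
  simp at hpos

end Haar

theorem eventually_forall_dist_lt {E : Type*} [PseudoMetricSpace E] {g : K → E}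
    (hg : Continuous g) {C : Set K} (hC : IsCompact C) {ε : ℝ} (hε : 0 < ε) :
    ∀ᶠ w in 𝓝 S.one, ∀ u ∈ C, ∀ z ∈ (S.conv u w).support, dist (g z) (g u) < ε := by
  refine hC.eventually_forall_of_forall_eventually fun u _ => ?_
  let V := {z | dist (g z) (g u) < ε / 2}
  have hV : IsOpen V := isOpen_lt (hg.dist continuous_const) continuous_const
  have huV : u ∈ V := by simp [V, hε]
  have hsupp : ∀ᶠ q : K × K in 𝓝 (S.one, u), (S.conv q.2 q.1).support ⊆ V :=
    continuous_swap.continuousAt.preimage_mem_nhds ((hS.isOpen_support_subset hV).mem_nhds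
      (by simpa only [Prod.swap_prod_mk, mem_ofPred_eq, hS.support_conv_one, singleton_subset_iff]))
  filter_upwards [hsupp, continuous_snd.continuousAt.preimage_mem_nhds (hV.mem_nhds huV)]
    with q hq hqu z hz
  exact dist_triangle_right (g z) (g q.2) (g u) |>.trans_lt (add_lt_add (hq hz) hqu) |>.trans_eq
    (add_halves ε)

theorem exists_symm_bump {m : Measure K} [IsFiniteMeasureOnCompacts m] [m.IsOpenPosMeasure]
    {U : Set K} (hU : U ∈ 𝓝 S.one) :
    ∃ k : C_c(K, ℝ), (∀ t, 0 ≤ k t) ∧ k ∘ S.inv = k ∧ tsupport k ⊆ U ∧ 0 < ∫ t, k t ∂m := by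
  obtain ⟨v, hv1, hvU, hv⟩ := exists_bump (isCompact_singleton (x := S.one))
    (U := interior U ∩ S.inv ⁻¹' interior U)
    (isOpen_interior.inter (isOpen_interior.preimage hS.continuous_inv))
    (by simpa [hS.inv_one] using mem_interior_iff_mem_nhds.2 hU)
  let k : C_c(K, ℝ) := v + v.comp hS.invHomeomorph.toCocompactMap
  have hk (t : K) : k t = v t + v (S.inv t) := rfl
  have hk0 : ∀ t, 0 ≤ k t := fun t => add_nonneg (hv t).1 (hv _).1
  refine ⟨k, hk0, funext fun t => ?_, ?_, ?_⟩
  · rw [Function.comp_apply, hk, hk, hS.inv_inv, add_comm]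
  · refine (tsupport_add _ _).trans (union_subset (fun t ht => interior_subset (hvU ht).1) ?_)
    refine (tsupport_comp_eq_preimage v hS.invHomeomorph).trans_subset fun t ht => ?_
    exact interior_subset (hS.inv_inv t ▸ (hvU ht).2)
  · refine k.continuous.integral_pos_of_hasCompactSupport_nonneg_nonzero k.hasCompactSupport hk0
      (x := S.one) ?_
    simp [hk, hS.inv_one, hv1 rfl]

section Adjoint

variable {m : Measure K}

theorem norm_smear_sub_smul_le {E : Type*} [NormedAddCommGroup E] [NormedSpace ℝ E]
    [CompleteSpace E] (hm : S.IsHaar m) {k : C_c(K, ℝ)} (hk : ∀ t, 0 ≤ k t) (g : C_c(K, E)) {u : K}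
    {ε : ℝ} (hε : ∀ w ∈ tsupport k, ∀ z ∈ (S.conv u w).support, dist (g z) (g u) < ε) :
    ‖S.smear m k g u - (∫ t, k t ∂m) • g u‖ ≤ ε * ∫ t, k t ∂m := by
  have := hm.finiteOnCompacts
  have hTk : Integrable (S.shift (S.inv u) k) m :=
    integrable_of_compactlySupported (hS.shiftCc (S.inv u) k) m
  have hTkg : Integrable (fun z => S.shift (S.inv u) k z • g z) m :=
    ((hS.continuous_shift _ k).smul g.continuous).integrable_of_hasCompactSupport
      g.hasCompactSupport.smul_left
  rw [← hm.integral_shift (S.inv u) k, ConvData.smear, ← integral_smul_const,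
    ← integral_sub hTkg (hTk.smul_const _), ← integral_const_mul]
  refine norm_integral_le_of_norm_le (hTk.const_mul ε) (.of_forall fun z => ?_)
  rw [← smul_sub, norm_smul, Real.norm_of_nonneg (S.shift_nonneg hk _ _), mul_comm ε]
  by_cases hz : S.shift (S.inv u) k z = 0
  · simp [hz]
  obtain ⟨_, rfl, w, hw, hzw⟩ := ConvData.mem_setMul.1 (hS.mem_setMul_of_shift_ne_zero hz)
  rw [hS.inv_inv] at hzw
  exact mul_le_mul_of_nonneg_left (dist_eq_norm (g z) (g u) ▸ (hε w hw z hzw).le)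
    (S.shift_nonneg hk _ _)

theorem abs_integral_mul_shift_smear_sub_le (hm : S.IsHaar m) {k : C_c(K, ℝ)} (hk : ∀ t, 0 ≤ k t)
    (f g : C_c(K, ℝ)) {x : K} {ε : ℝ}
    (hε : ∀ w ∈ tsupport k, ∀ u ∈ S.setMul {x} (tsupport f), ∀ z ∈ (S.conv u w).support,
      dist (g z) (g u) < ε) :
    |∫ y, f y * S.shift x (S.smear m k g) y ∂m - (∫ t, k t ∂m) * ∫ y, f y * S.shift x g y ∂m|
      ≤ (ε * ∫ t, k t ∂m) * ∫ y, |f y| ∂m := by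
  have := hm.finiteOnCompacts
  set c := ∫ t, k t ∂m
  have hpt : ∀ y ∈ tsupport f,
      ‖S.shift x (S.smear m k g) y - c * S.shift x g y‖ ≤ ε * c := fun y hy => by
    have := hS.isProbability x y
    rw [ConvData.shift, ConvData.shift, ← integral_const_mul, ← integral_sub
      (hS.integrable_conv (hS.continuous_smear k g) x y)
      ((hS.integrable_conv (map_continuous g) x y).const_mul c)]
    refine (norm_integral_le_of_norm_le_const (C := ε * c) ?_).trans (by simp)
    filter_upwards [hS.support_mem_ae x y] with u hu
    exact hS.norm_smear_sub_smul_le hm hk g fun w hw =>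
      hε w hw u (ConvData.mem_setMul.2 ⟨x, rfl, y, hy, hu⟩)
  have hint {φ : K → ℝ} (hφ : Continuous φ) : Integrable (fun y => f y * φ y) m :=
    (f.continuous.mul hφ).integrable_of_hasCompactSupport f.hasCompactSupport.mul_right
  rw [← integral_const_mul, ← integral_const_mul, ← integral_sub
    (hint (hS.continuous_shift_smear k g x))
    ((hint (hS.continuous_shift x g)).const_mul c),
    ← Real.norm_eq_abs]
  refine norm_integral_le_of_norm_le
    ((integrable_of_compactlySupported f m).abs.const_mul _) (.of_forall fun y => ?_)
  rw [mul_left_comm, ← mul_sub, norm_mul, mul_comm (ε * c)]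
  by_cases hy : y ∈ tsupport f
  · exact mul_le_mul_of_nonneg_left (hpt y hy) (norm_nonneg _)
  · simp [image_eq_zero_of_notMem_tsupport hy]

/- The kernel `(z, y) ↦ T_{z~} k(y)` of the operator `g ↦ smear k g` is symmetric if `k ∘ inv = k`,
so this operator is self-adjoint. -/
theorem integral_mul_shift_smear [IsFiniteMeasureOnCompacts m] {k : C_c(K, ℝ)}
    (hk : k ∘ S.inv = k) (f g : C_c(K, ℝ)) (x : K) :
    ∫ y, f y * S.shift x (S.smear m k g) y ∂m
      = ∫ z, g z * S.shift (S.inv x) (S.smear m k f) z ∂m := by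
  have hsymm (y z : K) :
      S.shift (S.inv y) (S.shift (S.inv x) k) z = S.shift (S.inv z) (S.shift x k) y := by
    have hkx : S.shift x k ∘ S.inv = S.shift (S.inv x) k := funext fun t => by
      rw [Function.comp_apply, ← hk, hS.shift_comp_inv, hS.inv_inv, hk]
    rw [← hkx, hS.shift_comp_inv, hS.inv_inv, hS.shift_swap]
  let F (y z : K) : ℝ := f y * (S.shift (S.inv y) (S.shift (S.inv x) k) z * g z)
  have hF : Continuous F.uncurry :=
    (f.continuous.comp continuous_fst).mul
      ((hS.continuous_shift_inv_uncurry (hS.shiftCc (S.inv x) k)).mul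
        (g.continuous.comp continuous_snd))
  have hFc : HasCompactSupport F.uncurry := by
    refine .intro (f.hasCompactSupport.isCompact.prod g.hasCompactSupport.isCompact) fun q hq => ?_
    obtain hq | hq := not_and_or.1 hq <;>
      simp [F, Function.uncurry, image_eq_zero_of_notMem_tsupport hq]
  calc ∫ y, f y * S.shift x (S.smear m k g) y ∂m = ∫ y, ∫ z, F y z ∂m ∂m := by
        simp only [F, integral_const_mul, hS.shift_smear_of_compactlySupported, ConvData.smear,
          smul_eq_mul, hS.shift_shift_comm k]
    _ = ∫ z, ∫ y, F y z ∂m ∂m := integral_integral_swap_of_hasCompactSupport hF hFc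
    _ = ∫ z, g z * S.shift (S.inv x) (S.smear m k f) z ∂m := by
        simp only [F, hsymm, hS.shift_smear_of_compactlySupported, ConvData.smear, smul_eq_mul,
          hS.inv_inv, ← integral_const_mul]
        congr! 4
        ring

theorem integral_shift_mul (hm : S.IsHaar m) (f g : C_c(K, ℝ)) (x : K) :
    ∫ y, S.shift x f y * g y ∂m = ∫ y, f y * S.shift (S.inv x) g y ∂m := by
  have := hm.finiteOnCompacts
  have := hS.isOpenPosMeasure hm
  let I := ∫ y, g y * S.shift x f y ∂m
  let J := ∫ y, f y * S.shift (S.inv x) g y ∂m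
  have hIJ : ∀ ε > 0, |I - J| ≤ (∫ y, |g y| ∂m + ∫ y, |f y| ∂m) * ε := fun ε hε => by
    obtain ⟨k, hk0, hk, hkU, hkpos⟩ := hS.exists_symm_bump (m := m) (inter_mem
      (hS.eventually_forall_dist_lt f.continuous
        (hS.isCompact_setMul (isCompact_singleton (x := x)) g.hasCompactSupport) hε)
      (hS.eventually_forall_dist_lt g.continuous
        (hS.isCompact_setMul (isCompact_singleton (x := S.inv x)) f.hasCompactSupport) hε))
    have hI := hS.abs_integral_mul_shift_smear_sub_le hm hk0 g f fun w hw => (hkU hw).1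
    have hJ := hS.abs_integral_mul_shift_smear_sub_le hm hk0 f g fun w hw => (hkU hw).2
    rw [← hS.integral_mul_shift_smear hk g f x, abs_sub_comm] at hJ
    refine le_of_mul_le_mul_left ?_ hkpos
    rw [← abs_of_pos hkpos, ← abs_mul, mul_sub, abs_of_pos hkpos, abs_sub_comm]
    refine (abs_sub_le _ _ _).trans ((add_le_add hJ hI).trans_eq ?_)
    ring
  have h : I = J := by
    by_contra! hne
    obtain ⟨ε, hε, hlt⟩ := exists_pos_mul_lt (abs_sub_pos.2 hne)
      (∫ y, |g y| ∂m + ∫ y, |f y| ∂m)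
    exact hlt.not_ge (hIJ ε hε)
  simpa only [I, J, mul_comm (g _)] using h

end Adjoint

section Measurability

theorem lowerSemicontinuous_conv (x : K) {U : Set K} (hU : IsOpen U) :
    LowerSemicontinuous fun y => S.conv x y U := by
  intro y c hc
  have := hS.regular x
  have := hS.isProbability x
  obtain ⟨C, hCU, hC, hcC⟩ := hU.exists_lt_isCompact hc
  obtain ⟨f, hfC, hfU, hf⟩ := exists_bump hC hU hCU
  have hcont : Continuous fun y => ENNReal.ofReal (S.shift x f y) :=
    ENNReal.continuous_ofReal.comp (hS.continuous_shift x f)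
  filter_upwards [hcont.continuousAt.eventually (lt_mem_nhds (hcC.trans_le
    (measure_le_ofReal_integral f (fun t => (hf t).1) hC.measurableSet hfC)))] with z hz
  exact hz.trans_le (ofReal_integral_le_measure f hf hfU)

theorem measurable_conv (x : K) : Measurable (S.conv x) :=
  have := hS.isProbability x
  Measurable.measure_of_isPiSystem_of_isProbabilityMeasure BorelSpace.measurable_eq
    isPiSystem_isOpen fun _ hU => (hS.lowerSemicontinuous_conv x hU).measurable

end Measurability

section Haar

variable {m : Measure K} (hm : S.IsHaar m)

include hm

theorem bind_conv_isOpen_le (x : K) (v : C_c(K, ℝ)) (hv : ∀ t, 0 ≤ v t) {U : Set K}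
    (hU : IsOpen U) :
    (m.withDensity fun y => ENNReal.ofReal (v y)).bind (S.conv x) U
      ≤ m.withDensity (fun y => ENNReal.ofReal (S.shift (S.inv x) v y)) U := by
  have := hm.finiteOnCompacts
  have := hm.innerRegular
  have := hS.isProbability x
  have := hS.regular x
  have := innerRegular_withDensity_ofReal (μ := m) v
  have : IsFiniteMeasure (m.withDensity fun y => ENNReal.ofReal (S.shift (S.inv x) v y)) :=
    isFiniteMeasure_withDensity_ofReal_compactlySupported (hS.shiftCc (S.inv x) v)
  let := Subtype.semilatticeSup (P := fun C : TopologicalSpace.Compacts K => (C : Set K) ⊆ U)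
    fun _ _ => union_subset
  have : Nonempty {C : TopologicalSpace.Compacts K // (C : Set K) ⊆ U} := ⟨⟨⊥, empty_subset U⟩⟩
  rw [Measure.bind_apply hU.measurableSet (hS.measurable_conv x).aemeasurable]
  simp_rw [measure_eq_iSup_interior_compacts hU]
  rw [lintegral_iSup_of_lowerSemicontinuous
    (F := fun (C : {C : TopologicalSpace.Compacts K // (C : Set K) ⊆ U}) y =>
      S.conv x y (interior C.1))
    (fun _ => hS.lowerSemicontinuous_conv x isOpen_interior)
    fun _ _ hCD _ => measure_mono (interior_mono hCD)]
  refine iSup_le fun C => ?_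
  obtain ⟨f, hfC, hfU, hf⟩ := exists_bump C.1.isCompact hU C.2
  have hf0 : ∀ t, 0 ≤ f t := fun t => (hf t).1
  calc ∫⁻ y, S.conv x y (interior C.1) ∂m.withDensity (fun y => ENNReal.ofReal (v y))
      ≤ ∫⁻ y, ENNReal.ofReal (S.shift x f y) ∂m.withDensity fun y => ENNReal.ofReal (v y) :=
        lintegral_mono fun y => measure_le_ofReal_integral f hf0 measurableSet_interior
          (hfC.mono interior_subset)
    _ = ENNReal.ofReal (∫ y, v y * S.shift x f y ∂m) :=
        lintegral_withDensity_ofReal v hv (hS.continuous_shift x f) (S.shift_nonneg hf0 x)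
    _ = ENNReal.ofReal (∫ y, S.shift (S.inv x) v y * f y ∂m) := by
        simp only [mul_comm, hS.integral_shift_mul hm f v x]
    _ = ENNReal.ofReal
          (∫ y, f y ∂m.withDensity fun y => ENNReal.ofReal (S.shift (S.inv x) v y)) :=
        congrArg ENNReal.ofReal (integral_withDensity_ofReal (hS.shiftCc (S.inv x) v)
          (S.shift_nonneg hv _) f).symm
    _ ≤ _ := ofReal_integral_le_measure f hf hfU

theorem bind_conv_withDensity (x : K) (v : C_c(K, ℝ)) (hv : ∀ t, 0 ≤ v t) :
    (m.withDensity fun y => ENNReal.ofReal (v y)).bind (S.conv x)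
      = m.withDensity (fun y => ENNReal.ofReal (S.shift (S.inv x) v y)) := by
  have := hm.finiteOnCompacts
  have := hm.innerRegular
  have := hS.isProbability x
  have hTv := S.shift_nonneg hv (S.inv x)
  have : IsFiniteMeasure (m.withDensity fun y => ENNReal.ofReal (S.shift (S.inv x) v y)) :=
    isFiniteMeasure_withDensity_ofReal_compactlySupported (hS.shiftCc (S.inv x) v)
  have : (m.withDensity fun y => ENNReal.ofReal (S.shift (S.inv x) v y)).InnerRegular :=
    innerRegular_withDensity_ofReal (hS.shiftCc (S.inv x) v)
  have huniv : (m.withDensity fun y => ENNReal.ofReal (v y)).bind (S.conv x) univ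
      = m.withDensity (fun y => ENNReal.ofReal (S.shift (S.inv x) v y)) univ := by
    rw [Measure.bind_apply MeasurableSet.univ (hS.measurable_conv x).aemeasurable]
    simp only [measure_univ, lintegral_const, one_mul]
    rw [withDensity_ofReal_univ v hv, ← hm.integral_shift (S.inv x) v]
    exact (withDensity_ofReal_univ (hS.shiftCc (S.inv x) v) hTv).symm
  have : IsFiniteMeasure ((m.withDensity fun y => ENNReal.ofReal (v y)).bind (S.conv x)) :=
    ⟨by rw [huniv]; exact measure_lt_top _ _⟩
  refine Measure.eq_of_le_of_measure_univ_eq (Measure.le_iff'.2 fun s => ?_) huniv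
  rw [s.measure_eq_iInf_isOpen (m.withDensity _)]
  exact le_iInf₂ fun U hsU => le_iInf fun hU =>
    (measure_mono hsU).trans (hS.bind_conv_isOpen_le hm x v hv hU)

theorem ae_conv_eq_zero (x : K) {N : Set K} (hN : m N = 0) : ∀ᵐ y ∂m, S.conv x y N = 0 := by
  wlog hNm : MeasurableSet N generalizing N
  · filter_upwards [this ((measure_toMeasurable N).trans hN) (measurableSet_toMeasurable m N)]
      with y hy using measure_mono_null (subset_toMeasurable m N) hy
  have := hm.finiteOnCompacts
  have := hm.innerRegular
  have hmeas : Measurable fun y => S.conv x y N :=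
    (Measure.measurable_coe hNm).comp (hS.measurable_conv x)
  by_contra hne
  obtain ⟨C, hCN, hC, hmC⟩ := (hmeas (measurableSet_singleton 0).compl).exists_lt_isCompact
    (pos_iff_ne_zero.2 hne)
  obtain ⟨v, hvC, -, hv⟩ := exists_bump hC isOpen_univ (subset_univ _)
  have hvm := (map_continuous v).measurable.ennreal_ofReal
  have h := congrArg (· N) (hS.bind_conv_withDensity hm x v fun t => (hv t).1)
  simp only [Measure.bind_apply hNm (hS.measurable_conv x).aemeasurable] at h
  rw [withDensity_absolutelyContinuous _ _ hN, lintegral_withDensity_eq_lintegral_mul _ hvm hmeas,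
    lintegral_eq_zero_iff (hvm.mul hmeas)] at h
  refine hmC.ne' (measure_eq_zero_iff_ae_notMem.2 ?_)
  filter_upwards [h] with y hy hyC
  exact hCN hyC (by simpa [hvC hyC] using hy)

theorem shift_congr_ae {E : Type*} [NormedAddCommGroup E] [NormedSpace ℝ E] (x : K) {f g : K → E}
    (h : f =ᵐ[m] g) : S.shift x f =ᵐ[m] S.shift x g := by
  filter_upwards [hS.ae_conv_eq_zero hm x h] with y hy using integral_congr_ae hy

theorem integral_smul_shift {E : Type*} [NormedAddCommGroup E] [NormedSpace ℝ E]
    (x : K) (v : C_c(K, ℝ)) (hv : ∀ t, 0 ≤ v t) {f : K → E} (hf : AEStronglyMeasurable f m)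
    {M : ℝ} (hfM : ∀ᵐ y ∂m, ‖f y‖ ≤ M) :
    ∫ y, v y • S.shift x f y ∂m = ∫ y, S.shift (S.inv x) v y • f y ∂m := by
  have := hm.finiteOnCompacts
  let κ : ProbabilityTheory.Kernel K K := ⟨S.conv x, hS.measurable_conv x⟩
  have : ProbabilityTheory.IsMarkovKernel κ := ⟨hS.isProbability x⟩
  have : IsFiniteMeasure (m.withDensity fun y => ENNReal.ofReal (S.shift (S.inv x) v y)) :=
    isFiniteMeasure_withDensity_ofReal_compactlySupported (hS.shiftCc (S.inv x) v)
  have hbind : (m.withDensity fun y => ENNReal.ofReal (v y)).bind κ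
      = m.withDensity (fun y => ENNReal.ofReal (S.shift (S.inv x) v y)) :=
    hS.bind_conv_withDensity hm x v hv
  have hac := withDensity_absolutelyContinuous m
    (fun y => ENNReal.ofReal (S.shift (S.inv x) v y))
  have hint : Integrable f ((m.withDensity fun y => ENNReal.ofReal (v y)).bind κ) :=
    hbind ▸ Integrable.of_bound (hf.mono_ac hac) M (hac.ae_le hfM)
  calc ∫ y, v y • S.shift x f y ∂m
      = ∫ y, ∫ z, f z ∂κ y ∂m.withDensity fun y => ENNReal.ofReal (v y) :=
        (integral_withDensity_ofReal v hv _).symm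
    _ = ∫ y, f y ∂m.withDensity fun y => ENNReal.ofReal (S.shift (S.inv x) v y) := by
        rw [← hbind, Measure.comp_eq_comp_const_apply, ProbabilityTheory.Kernel.integral_comp
          (Measure.comp_eq_comp_const_apply (κ := κ) ▸ hint), ProbabilityTheory.Kernel.const_apply]
    _ = ∫ y, S.shift (S.inv x) v y • f y ∂m :=
        integral_withDensity_ofReal (hS.shiftCc (S.inv x) v) (S.shift_nonneg hv _) f

end Haar

theorem tendsto_integral_abs_shift_sub {m : Measure K} [IsFiniteMeasureOnCompacts m]
    (v : C_c(K, ℝ)) (x : K) :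
    Tendsto (fun z => ∫ y, |S.shift z v y - S.shift x v y| ∂m) (𝓝 x) (𝓝 0) := by
  obtain ⟨D, hD, hDx⟩ := exists_compact_mem_nhds x
  have hzero {z y : K} (hz : z ∈ D) (hy : y ∉ S.setMul (S.inv '' D) (tsupport v)) :
      S.shift z v y = 0 := by
    by_contra h
    obtain ⟨_, rfl, t, ht, hyt⟩ := ConvData.mem_setMul.1 (hS.mem_setMul_of_shift_ne_zero h)
    exact hy (ConvData.mem_setMul.2 ⟨_, mem_image_of_mem _ hz, t, ht, hyt⟩)
  have hcont : Continuous fun q : K × K => |S.shift q.1 v q.2 - S.shift x v q.2| :=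
    ((hS.continuous_shift_uncurry v).sub ((hS.continuous_shift x v).comp continuous_snd)).abs
  have hcontOn := continuousOn_integral_of_compact_support (μ := m)
    (s := D) (f := fun z y => |S.shift z v y - S.shift x v y|)
    (hS.isCompact_setMul (hD.image hS.continuous_inv) v.hasCompactSupport) hcont.continuousOn
    fun z y hz hy => by simp [hzero hz hy, hzero (mem_of_mem_nhds hDx) hy]
  simpa using (hcontOn.continuousAt hDx).tendsto

/-! ### Cosets and the quotient hypergroup -/

section Cosets

variable {H : Set K}

section Coset

theorem mem_coset_iff_nonempty_inter {x y : K} :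
    x ∈ S.coset H y ↔ ((S.conv x (S.inv y)).support ∩ H).Nonempty := by
  rw [ConvData.mem_coset, inter_comm]
  refine exists_congr fun h => and_congr_right fun _ => ?_
  rw [hS.mem_support_conv_inv_iff, hS.comm]

variable (hH : S.IsSubhypergroup H)

include hH

theorem one_mem : S.one ∈ H := by
  obtain ⟨h, hh⟩ := hH.nonempty
  exact hH.mem_of_mem_support hh (hH.inv_mem hh)
    ((hS.one_mem_support _ _).2 (hS.inv_inv h).symm)

theorem self_mem_coset (x : K) : x ∈ S.coset H x :=
  ConvData.mem_coset.2 ⟨_, hS.one_mem hH, hS.support_conv_one x ▸ rfl⟩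

theorem coset_subset_of_mem {x y : K} (h : x ∈ S.coset H y) : S.coset H x ⊆ S.coset H y := by
  intro z hz
  obtain ⟨a, ha, hx⟩ := ConvData.mem_coset.1 h
  obtain ⟨b, hb, hz⟩ := ConvData.mem_coset.1 hz
  obtain ⟨w, hw, hzw⟩ := hS.exists_mem_support_of_mem_support_conv hx hz
  exact ConvData.mem_coset.2 ⟨w, hH.mem_of_mem_support ha hb hw, hzw⟩

theorem mem_coset_symm {x y : K} (h : x ∈ S.coset H y) : y ∈ S.coset H x := by
  obtain ⟨a, ha, hx⟩ := ConvData.mem_coset.1 h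
  exact ConvData.mem_coset.2 ⟨S.inv a, hH.inv_mem ha, hS.mem_support_conv_inv hx⟩

theorem coset_eq_iff {x y : K} : S.coset H x = S.coset H y ↔ x ∈ S.coset H y :=
  ⟨fun h => h ▸ hS.self_mem_coset hH x, fun h => Subset.antisymm (hS.coset_subset_of_mem hH h)
    (hS.coset_subset_of_mem hH (hS.mem_coset_symm hH h))⟩

end Coset

section Proj

variable (hH : S.IsSubhypergroup H)

include hH

theorem proj_eq_iff {x y : K} : S.proj H x = S.proj H y ↔ x ∈ S.coset H y :=
  Quotient.eq.trans (hS.coset_eq_iff hH)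

theorem proj_eq_proj_one_iff {x : K} : S.proj H x = S.proj H S.one ↔ x ∈ H := by
  simp [hS.proj_eq_iff hH, ConvData.mem_coset, hS.support_one_conv]

theorem proj_eq_of_mem_support {x y h : K} (hh : h ∈ H) (hx : x ∈ (S.conv h y).support) :
    S.proj H x = S.proj H y :=
  (hS.proj_eq_iff hH).2 (ConvData.mem_coset.2 ⟨h, hh, hS.comm h y ▸ hx⟩)

theorem proj_inv_congr {x y : K} (h : S.proj H x = S.proj H y) :
    S.proj H (S.inv x) = S.proj H (S.inv y) := by
  obtain ⟨a, ha, hx⟩ := ConvData.mem_coset.1 ((hS.proj_eq_iff hH).1 h)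
  exact hS.proj_eq_of_mem_support hH (hH.inv_mem ha) (hS.comm _ _ ▸ hS.inv_mem_support hx)

theorem isOpenQuotientMap_proj : IsOpenQuotientMap (S.proj H) := by
  refine ⟨Quotient.mk_surjective, S.continuous_proj H, fun U hU => ?_⟩
  change IsOpen (S.proj H ⁻¹' (S.proj H '' U))
  rw [isOpen_iff_mem_nhds]
  rintro z ⟨u, hu, huz⟩
  obtain ⟨h, hh, huz⟩ := ConvData.mem_coset.1 ((hS.proj_eq_iff hH).1 huz)
  filter_upwards [((hS.isOpen_support_inter hU).preimage (Continuous.prodMk_right h)).mem_nhds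
    ⟨u, hS.comm z h ▸ huz, hu⟩] with z' ⟨u', hu', hu'U⟩
  exact ⟨u', hu'U, hS.proj_eq_of_mem_support hH hh hu'⟩

theorem t2Space_quot : T2Space (S.QuotSpace H) := by
  rw [t2Space_iff_of_isOpenQuotientMap (hS.isOpenQuotientMap_proj hH), ← isOpen_compl_iff]
  convert (hS.isOpen_support_subset hH.isClosed.isOpen_compl).preimage
    (continuous_id.prodMap hS.continuous_inv) using 1
  ext q
  simp only [mem_compl_iff, mem_ofPred_eq, hS.proj_eq_iff hH, hS.mem_coset_iff_nonempty_inter,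
    not_nonempty_iff_eq_empty, mem_preimage, Prod.map_fst, Prod.map_snd, id_eq,
    ← disjoint_iff_inter_eq_empty, subset_compl_iff_disjoint_right]

theorem locallyCompactSpace_quot : LocallyCompactSpace (S.QuotSpace H) :=
  (hS.isOpenQuotientMap_proj hH).locallyCompactSpace

theorem shift_comp_proj_of_mem {E : Type*} [NormedAddCommGroup E] [NormedSpace ℝ E]
    [CompleteSpace E] (f : S.QuotSpace H → E) {h : K} (hh : h ∈ H) (x : K) :
    S.shift h (f ∘ S.proj H) x = f (S.proj H x) :=
  hS.shift_eq_of_forall_mem_support fun _ ht =>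
    congrArg f (hS.proj_eq_of_mem_support hH hh ht)

end Proj

section Invariant

theorem support_conv_subsingleton (hH : S.IsSubgroup H) {h : K} (hh : h ∈ H) (y : K) :
    (S.conv h y).support.Subsingleton := by
  intro a ha b hb
  obtain ⟨z, -, hz⟩ := hH.conv_eq_dirac h hh _ (hH.inv_mem hh)
  have hsub : (S.conv h (S.inv h)).support ⊆ {z} := by
    refine Measure.support_subset_of_isClosed isClosed_singleton ?_
    rw [hz]
    exact (mem_ae_dirac_iff (measurableSet_singleton z)).2 rfl
  have hone : S.one ∈ (S.conv h (S.inv h)).support :=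
    (hS.one_mem_support _ _).2 (hS.inv_inv h).symm
  rw [hS.comm] at ha hb hsub hone
  obtain ⟨w, hw, haw⟩ := hS.exists_mem_support_of_mem_support_conv (hS.mem_support_conv_inv hb) ha
  rwa [(hsub hw).trans (hsub hone).symm, hS.support_conv_one] at haw

theorem eq_of_mem_coset_of_isSubgroup {E : Type*} [NormedAddCommGroup E] [NormedSpace ℝ E]
    [CompleteSpace E] (hH : S.IsSubgroup H) {G : K → E}
    (hG : ∀ h ∈ H, ∀ x, S.shift h G x = G x) {x y : K} (hx : x ∈ S.coset H y) : G x = G y := by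
  obtain ⟨h, hh, hx⟩ := ConvData.mem_coset.1 hx
  rw [hS.comm] at hx
  rw [← hG h hh y]
  exact (hS.shift_eq_of_forall_mem_support fun t ht => by
    rw [hS.support_conv_subsingleton hH hh y ht hx]).symm

theorem eq_of_mem_coset_of_isCompact (hH : S.IsSubhypergroup H) (hHc : IsCompact H) {G : K → ℝ}
    (hGc : Continuous G) (hG : ∀ h ∈ H, ∀ x, S.shift h G x = G x) {x y : K}
    (hx : x ∈ S.coset H y) : G x = G y := by
  obtain ⟨z, hz, hmax⟩ : ∃ z ∈ S.coset H y, ∀ s ∈ S.coset H y, G s ≤ G z :=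
    (hS.isCompact_setMul isCompact_singleton hHc).exists_isMaxOn ⟨y, hS.self_mem_coset hH y⟩
      hGc.continuousOn
  have hzy : S.coset H z = S.coset H y := (hS.coset_eq_iff hH).2 hz
  suffices eq_max : ∀ t ∈ S.coset H y, G t = G z from
    (eq_max x hx).trans (eq_max y (hS.self_mem_coset hH y)).symm
  intro t ht
  obtain ⟨h, hh, ht⟩ := ConvData.mem_coset.1 (hzy.symm ▸ ht)
  rw [hS.comm] at ht
  have hle : ∀ s ∈ (S.conv h z).support, G s ≤ G z := fun s hs =>
    hmax s (hzy ▸ ConvData.mem_coset.2 ⟨h, hh, hS.comm h z ▸ hs⟩)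
  have hint := hS.integrable_conv hGc h z
  have := hS.isProbability h z
  have hzero : S.shift h (fun s => max (G z - G s) 0) z = 0 := by
    rw [hS.shift_congr (g := fun s => G z - G s)
      fun s hs => max_eq_left (sub_nonneg.2 (hle s hs)), ConvData.shift,
      integral_sub (integrable_const _) hint]
    simp [← hG h hh z, ConvData.shift]
  refine le_antisymm (hle t ht) (not_lt.1 fun hlt => hzero.not_gt ?_)
  exact hS.shift_pos_of_mem_support ((continuous_const.sub hGc).max continuous_const)
    (fun _ => le_max_right _ _) ht (lt_max_of_lt_left (sub_pos.2 hlt))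

theorem eq_of_proj_eq_of_shift_eq (hH : S.IsSubgroup H ∨ (S.IsSubhypergroup H ∧ IsCompact H))
    {G : K → ℝ} (hGc : Continuous G) (hG : ∀ h ∈ H, ∀ x, S.shift h G x = G x) {x y : K}
    (hxy : S.proj H x = S.proj H y) : G x = G y := by
  rw [hS.proj_eq_iff (ConvData.isSubhypergroup_of_isSubgroup_or_isCompact hH)] at hxy
  obtain hH | ⟨hH, hHc⟩ := hH
  · exact hS.eq_of_mem_coset_of_isSubgroup hH hG hxy
  · exact hS.eq_of_mem_coset_of_isCompact hH hHc hGc hG hxy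

end Invariant

end Cosets

section Quotient

variable {H : Set K} (hH : S.IsSubgroup H ∨ (S.IsSubhypergroup H ∧ IsCompact H))

include hH

section QuotConv

theorem shift_pullback_congr (f : S.QuotSpace H →ᵇ ℝ) {x x' y y' : K}
    (hx : S.proj H x = S.proj H x') (hy : S.proj H y = S.proj H y') :
    S.shift x (f ∘ S.proj H) y = S.shift x' (f ∘ S.proj H) y' := by
  have hH' := ConvData.isSubhypergroup_of_isSubgroup_or_isCompact hH
  let F : K →ᵇ ℝ := f.compContinuous ⟨S.proj H, S.continuous_proj H⟩
  have congr_right (z : K) {a b : K} (hab : S.proj H a = S.proj H b) :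
      S.shift z F a = S.shift z F b := by
    refine hS.eq_of_proj_eq_of_shift_eq hH (hS.continuous_shift z F) (fun h hh t => ?_) hab
    rw [hS.shift_shift_comm]
    exact congrArg (S.shift z · t) (funext (hS.shift_comp_proj_of_mem hH' f hh))
  calc S.shift x F y = S.shift x F y' := congr_right x hy
    _ = S.shift y' F x := hS.shift_swap _ _ _
    _ = S.shift y' F x' := congr_right y' hx
    _ = S.shift x' F y' := hS.shift_swap _ _ _

theorem regular_map_proj (x y : K) : ((S.conv x y).map (S.proj H)).Regular := by
  have := hS.t2Space_quot (ConvData.isSubhypergroup_of_isSubgroup_or_isCompact hH)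
  have := hS.isProbability x y
  have := hS.regular x y
  have := Measure.InnerRegular.map_of_continuous (μ := S.conv x y) (S.continuous_proj H)
  have := Measure.isProbabilityMeasure_map (μ := S.conv x y) (S.continuous_proj H).aemeasurable
  infer_instance

theorem map_proj_congr {x x' y y' : K}
    (hx : S.proj H x = S.proj H x') (hy : S.proj H y = S.proj H y') :
    (S.conv x y).map (S.proj H) = (S.conv x' y').map (S.proj H) := by
  have hH' := ConvData.isSubhypergroup_of_isSubgroup_or_isCompact hH
  have := hS.t2Space_quot hH'
  have := hS.locallyCompactSpace_quot hH'
  have := hS.regular_map_proj hH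
  have := hS.isProbability
  refine Measure.ext_of_integral_eq_on_compactlySupported fun f => ?_
  have hf := map_continuous f
  rw [integral_map (S.continuous_proj H).aemeasurable hf.aestronglyMeasurable,
    integral_map (S.continuous_proj H).aemeasurable hf.aestronglyMeasurable]
  exact hS.shift_pullback_congr hH (f : S.QuotSpace H →ᵇ ℝ) hx hy

theorem quot_conv_proj (x y : K) :
    (S.quot H).conv (S.proj H x) (S.proj H y) = (S.conv x y).map (S.proj H) :=
  hS.map_proj_congr hH (S.proj_rep H _) (S.proj_rep H _)

theorem quot_inv_proj (x : K) : (S.quot H).inv (S.proj H x) = S.proj H (S.inv x) :=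
  hS.proj_inv_congr (ConvData.isSubhypergroup_of_isSubgroup_or_isCompact hH) (S.proj_rep H _)

theorem quot_shift_proj {E : Type*} [NormedAddCommGroup E] [NormedSpace ℝ E]
    {f : S.QuotSpace H → E} {x y : K}
    (hf : AEStronglyMeasurable f ((S.quot H).conv (S.proj H x) (S.proj H y))) :
    (S.quot H).shift (S.proj H x) f (S.proj H y) = S.shift x (f ∘ S.proj H) y := by
  rw [hS.quot_conv_proj hH] at hf
  rw [ConvData.shift, hS.quot_conv_proj hH]
  exact integral_map (S.continuous_proj H).aemeasurable hf

theorem quot_shift_proj_of_continuous {𝕜 : Type*} [RCLike 𝕜] {f : S.QuotSpace H → 𝕜}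
    (hf : Continuous f) (x y : K) :
    (S.quot H).shift (S.proj H x) f (S.proj H y) = S.shift x (f ∘ S.proj H) y :=
  hS.quot_shift_proj hH hf.aestronglyMeasurable

theorem support_quot_conv_proj (x y : K) :
    ((S.quot H).conv (S.proj H x) (S.proj H y)).support = S.proj H '' (S.conv x y).support := by
  have := hS.t2Space_quot (ConvData.isSubhypergroup_of_isSubgroup_or_isCompact hH)
  have := hS.regular x y
  rw [hS.quot_conv_proj hH]
  exact support_map_of_isCompact (hS.isCompact_support x y) (S.continuous_proj H)

end QuotConv

section QuotAxioms

theorem continuous_quot_conv (f : S.QuotSpace H →ᵇ ℝ) :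
    Continuous fun q : S.QuotSpace H × S.QuotSpace H => ∫ t, f t ∂(S.quot H).conv q.1 q.2 := by
  have hq := hS.isOpenQuotientMap_proj (ConvData.isSubhypergroup_of_isSubgroup_or_isCompact hH)
  rw [← (hq.prodMap hq).continuous_comp_iff]
  exact (hS.continuous_conv (f.compContinuous ⟨S.proj H, S.continuous_proj H⟩)).congr
    fun q => (hS.quot_shift_proj_of_continuous hH f.continuous q.1 q.2).symm

theorem continuous_quot_support :
    @Continuous (S.QuotSpace H × S.QuotSpace H) (Set (S.QuotSpace H)) _
      (TopologicalSpace.vietoris _) fun q => ((S.quot H).conv q.1 q.2).support := by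
  have hq := hS.isOpenQuotientMap_proj (ConvData.isSubhypergroup_of_isSubgroup_or_isCompact hH)
  let _ := TopologicalSpace.vietoris K
  let _ := TopologicalSpace.vietoris (S.QuotSpace H)
  rw [← (hq.prodMap hq).continuous_comp_iff]
  exact ((S.continuous_proj H).image_vietoris.comp hS.continuous_support).congr
    fun q => (hS.support_quot_conv_proj hH q.1 q.2).symm

theorem quot_shift_shift_rotate (f : S.QuotSpace H →ᵇ ℝ) (a b c : S.QuotSpace H) :
    ∫ u, (∫ t, f t ∂(S.quot H).conv u c) ∂(S.quot H).conv a b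
      = ∫ u, (∫ t, f t ∂(S.quot H).conv a u) ∂(S.quot H).conv b c := by
  have hq := hS.isOpenQuotientMap_proj (ConvData.isSubhypergroup_of_isSubgroup_or_isCompact hH)
  obtain ⟨x, rfl⟩ := hq.surjective a
  obtain ⟨y, rfl⟩ := hq.surjective b
  obtain ⟨z, rfl⟩ := hq.surjective c
  have hcont := hS.continuous_quot_conv hH f
  refine (hS.quot_shift_proj hH (f := fun u => (S.quot H).shift u f (S.proj H z))
    (hcont.comp (Continuous.prodMk_left (S.proj H z))).aestronglyMeasurable).trans <| .trans ?_
    (hS.quot_shift_proj hH (f := fun u => (S.quot H).shift (S.proj H x) f u)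
    (hcont.comp (Continuous.prodMk_right (S.proj H x))).aestronglyMeasurable).symm
  simp only [Function.comp_def, hS.quot_shift_proj_of_continuous hH f.continuous]
  exact hS.assoc (f.compContinuous ⟨S.proj H, S.continuous_proj H⟩) x y z

theorem continuous_quot_inv : Continuous (S.quot H).inv := by
  have hq := hS.isOpenQuotientMap_proj (ConvData.isSubhypergroup_of_isSubgroup_or_isCompact hH)
  rw [← hq.continuous_comp_iff]
  exact ((S.continuous_proj H).comp hS.continuous_inv).congr
    fun x => (hS.quot_inv_proj hH x).symm

theorem map_quot_inv (a b : S.QuotSpace H) :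
    ((S.quot H).conv a b).map (S.quot H).inv
      = (S.quot H).conv ((S.quot H).inv b) ((S.quot H).inv a) := by
  have hq := hS.isOpenQuotientMap_proj (ConvData.isSubhypergroup_of_isSubgroup_or_isCompact hH)
  obtain ⟨x, rfl⟩ := hq.surjective a
  obtain ⟨y, rfl⟩ := hq.surjective b
  have hinv : (S.quot H).inv ∘ S.proj H = S.proj H ∘ S.inv := funext (hS.quot_inv_proj hH)
  rw [hS.quot_inv_proj hH, hS.quot_inv_proj hH, hS.quot_conv_proj hH, hS.quot_conv_proj hH,
    ← hS.map_inv,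
    Measure.map_map (hS.continuous_quot_inv hH).measurable (S.continuous_proj H).measurable, hinv,
    Measure.map_map (S.continuous_proj H).measurable hS.continuous_inv.measurable]

theorem quot_one_mem_support_iff (a b : S.QuotSpace H) :
    (S.quot H).one ∈ ((S.quot H).conv a b).support ↔ a = (S.quot H).inv b := by
  have hH' := ConvData.isSubhypergroup_of_isSubgroup_or_isCompact hH
  have hq := hS.isOpenQuotientMap_proj hH'
  obtain ⟨x, rfl⟩ := hq.surjective a
  obtain ⟨y, rfl⟩ := hq.surjective b
  rw [hS.support_quot_conv_proj hH, hS.quot_inv_proj hH, hS.proj_eq_iff hH',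
    hS.mem_coset_iff_nonempty_inter, hS.inv_inv]
  exact exists_congr fun t => and_congr_right fun _ => hS.proj_eq_proj_one_iff hH'

theorem isCommHypergroup_quot [T2Space (S.QuotSpace H)] [LocallyCompactSpace (S.QuotSpace H)] :
    IsCommHypergroup (S.quot H) where
  isProbability a b := by
    have := hS.isProbability (S.rep H a) (S.rep H b)
    exact Measure.isProbabilityMeasure_map (S.continuous_proj H).aemeasurable
  regular a b := hS.regular_map_proj hH _ _
  isCompact_support a b := by
    rw [← S.proj_rep H a, ← S.proj_rep H b, hS.support_quot_conv_proj hH]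
    exact (hS.isCompact_support _ _).image (S.continuous_proj H)
  continuous_conv := hS.continuous_quot_conv hH
  continuous_support := hS.continuous_quot_support hH
  assoc := hS.quot_shift_shift_rotate hH
  one_conv a := by
    rw [← S.proj_rep H a]
    exact (hS.quot_conv_proj hH S.one _).trans (by
      rw [hS.one_conv, Measure.map_dirac' (S.continuous_proj H).measurable])
  comm a b := congrArg (Measure.map (S.proj H)) (hS.comm _ _)
  continuous_inv := hS.continuous_quot_inv hH
  inv_inv a := by
    rw [← S.proj_rep H a, hS.quot_inv_proj hH, hS.quot_inv_proj hH, hS.inv_inv]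
  map_inv := hS.map_quot_inv hH
  one_mem_support := hS.quot_one_mem_support_iff hH

end QuotAxioms

end Quotient

/-! ### The canonical projection and Haar measures -/

section Nonsingularity

variable {m : Measure K} (hm : S.IsHaar m)

section HaarBounds

theorem eventually_forall_half_lt_shift_inv {C : Set K} (hC : IsCompact C) (v : C_c(K, ℝ))
    (hv : EqOn v 1 C) : ∀ᶠ y in 𝓝 S.one, ∀ x ∈ C, 1 / 2 < S.shift (S.inv y) v x := by
  refine hC.eventually_forall_of_forall_eventually fun x hx => ?_
  refine (hS.continuous_shift_inv_uncurry v).continuousAt.eventually (lt_mem_nhds ?_)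
  simp only [hS.inv_one, hS.shift_one, hv hx, Pi.one_apply]
  norm_num

include hm

theorem integral_mul_shift_le (x : K) (w f : C_c(K, ℝ)) (hw : ∀ t, w t ∈ Icc 0 1)
    (hf : ∀ t, 0 ≤ f t) : ∫ y, w y * S.shift x f y ∂m ≤ ∫ y, f y ∂m := by
  have := hm.finiteOnCompacts
  simp only [mul_comm (w _), hS.integral_shift_mul hm f w x]
  refine integral_mono (((map_continuous f).mul (hS.continuous_shift _ w)
    ).integrable_of_hasCompactSupport f.hasCompactSupport.mul_right)
    (integrable_of_compactlySupported f m) fun y => mul_le_of_le_one_right (hf y) ?_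
  have hw1 : ∀ t, ‖w t‖ ≤ 1 := fun t => (Real.norm_of_nonneg (hw t).1).trans_le (hw t).2
  exact (Real.le_norm_self _).trans (hS.norm_shift_le hw1 _ _)

theorem mul_measureReal_le_integral_mul_shift {C : Set K} (hC : IsCompact C) {a : ℝ}
    (v : C_c(K, ℝ)) (hv : ∀ t, 0 ≤ v t) (y : K) (hva : ∀ x ∈ C, a ≤ S.shift (S.inv y) v x)
    {f : K → ℝ} (hfm : AEStronglyMeasurable f m) (hf : ∀ t, f t ∈ Icc 0 1) (hf1 : EqOn f 1 C) :
    a * m.real C ≤ ∫ x, v x * S.shift y f x ∂m := by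
  have := hm.finiteOnCompacts
  have hbound : ∀ t, ‖f t‖ ≤ 1 := fun t => (abs_of_nonneg (hf t).1).trans_le (hf t).2
  have hint : Integrable (fun x => S.shift (S.inv y) v x • f x) m :=
    (integrable_of_compactlySupported (hS.shiftCc (S.inv y) v) m).smul_of_top_left
      (memLp_top_of_bound hfm 1 (.of_forall hbound))
  calc a * m.real C = ∫ _ in C, a ∂m := by rw [setIntegral_const, smul_eq_mul, mul_comm]
    _ ≤ ∫ x in C, S.shift (S.inv y) v x • f x ∂m := by
        refine setIntegral_mono_on (integrableOn_const hC.measure_ne_top) hint.integrableOn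
          hC.measurableSet fun x hx => ?_
        rw [hf1 hx, Pi.one_apply, smul_eq_mul, mul_one]
        exact hva x hx
    _ ≤ ∫ x, S.shift (S.inv y) v x • f x ∂m := setIntegral_le_integral hint
        (.of_forall fun x => mul_nonneg (S.shift_nonneg hv _ x) (hf x).1)
    _ = ∫ x, v x * S.shift y f x ∂m :=
        (hS.integral_smul_shift hm y v hv hfm (.of_forall hbound)).symm

end HaarBounds

section Nonsingular

variable {H : Set K} (hH : S.IsSubgroup H ∨ (S.IsSubhypergroup H ∧ IsCompact H))
  {m' : Measure (S.QuotSpace H)} (hm' : (S.quot H).IsHaar m')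

include hH hm hm'

/- Both sides estimate the double integral of `v(x) w(b) T_{xH} f(b)`: it is at most `∫ v · ∫ f`
since `w ≤ 1`, and for `b = yH` with `y` near `e` the `x`-integral is
`w(b) ∫ T_{y~} v · (f ∘ p)`. -/
theorem half_measureReal_mul_integral_le {C : Set K} (hC : IsCompact C) (v : C_c(K, ℝ))
    (hv : ∀ t, 0 ≤ v t) (w : C_c(S.QuotSpace H, ℝ)) (hw : ∀ b, w b ∈ Icc 0 1)
    (hvw : tsupport w ⊆ S.proj H '' {y | ∀ x ∈ C, 1 / 2 < S.shift (S.inv y) v x})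
    (f : C_c(S.QuotSpace H, ℝ)) (hf : ∀ b, f b ∈ Icc 0 1) (hf1 : EqOn f 1 (S.proj H '' C)) :
    1 / 2 * m.real C * ∫ b, w b ∂m' ≤ (∫ b, f b ∂m') * ∫ x, v x ∂m := by
  have hH' := ConvData.isSubhypergroup_of_isSubgroup_or_isCompact hH
  have := hS.t2Space_quot hH'
  have := hS.locallyCompactSpace_quot hH'
  have hQ := hS.isCommHypergroup_quot hH
  have := hm.finiteOnCompacts
  have := hm'.finiteOnCompacts
  let F (x : K) (b : S.QuotSpace H) : ℝ := v x * (w b * (S.quot H).shift (S.proj H x) f b)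
  have hF : Continuous F.uncurry :=
    ((map_continuous v).comp continuous_fst).mul (((map_continuous w).comp continuous_snd).mul
      ((hQ.continuous_shift_uncurry f).comp
        (((S.continuous_proj H).comp continuous_fst).prodMk continuous_snd)))
  have hFc : HasCompactSupport F.uncurry := by
    refine .intro (v.hasCompactSupport.isCompact.prod w.hasCompactSupport.isCompact) fun q hq => ?_
    obtain hq | hq := not_and_or.1 hq <;>
      simp [F, Function.uncurry, image_eq_zero_of_notMem_tsupport hq]
  refine mul_integral_le_mul_integral_of_kernel hF hFc v w (fun b => ?_) fun x => ?_
  · by_cases hb : w b = 0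
    · simp [F, hb]
    obtain ⟨y, hy, rfl⟩ := hvw (subset_tsupport _ hb)
    have hle := hS.mul_measureReal_le_integral_mul_shift hm hC v hv y (fun x hx => (hy x hx).le)
      ((map_continuous f).comp (S.continuous_proj H)).aestronglyMeasurable
      (fun t => hf (S.proj H t)) fun x hx => hf1 (mem_image_of_mem _ hx)
    calc 1 / 2 * m.real C * w (S.proj H y)
        ≤ (∫ x, v x * S.shift y (f ∘ S.proj H) x ∂m) * w (S.proj H y) :=
          mul_le_mul_of_nonneg_right hle (hw _).1
      _ = ∫ x, F x (S.proj H y) ∂m := by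
          rw [← integral_mul_const]
          refine integral_congr_ae (.of_forall fun x => ?_)
          simp only [F, hS.quot_shift_proj_of_continuous hH (map_continuous f), hS.shift_swap _ y]
          ring
  · rw [integral_const_mul, mul_comm]
    exact mul_le_mul_of_nonneg_right
      (hQ.integral_mul_shift_le hm' (S.proj H x) w f hw fun b => (hf b).1) (hv x)

theorem exists_pos_forall_le_integral {C : Set K} (hC : IsCompact C) (hmC : 0 < m C) :
    ∃ c > 0, ∀ f : C_c(S.QuotSpace H, ℝ), EqOn f 1 (S.proj H '' C) → (∀ b, f b ∈ Icc 0 1) →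
      c ≤ ∫ b, f b ∂m' := by
  have hH' := ConvData.isSubhypergroup_of_isSubgroup_or_isCompact hH
  have hp := hS.isOpenQuotientMap_proj hH'
  have := hS.t2Space_quot hH'
  have := hS.locallyCompactSpace_quot hH'
  have := (hS.isCommHypergroup_quot hH).isOpenPosMeasure hm'
  have := hS.isOpenPosMeasure hm
  have := hm.finiteOnCompacts
  have := hm'.finiteOnCompacts
  obtain ⟨x₀, hx₀⟩ := nonempty_of_measure_ne_zero hmC.ne'
  obtain ⟨v, hvC, -, hv⟩ := exists_bump hC isOpen_univ (subset_univ _)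
  obtain ⟨Y, hY, hYo, hYone⟩ :=
    eventually_nhds_iff.1 (hS.eventually_forall_half_lt_shift_inv hC v hvC)
  obtain ⟨w, hw1, hwY, hw⟩ := exists_bump (isCompact_singleton (x := S.proj H S.one))
    (hp.isOpenMap Y hYo) (singleton_subset_iff.2 (mem_image_of_mem _ hYone))
  have integral_pos {Z : Type _} [TopologicalSpace Z] [MeasurableSpace Z] [OpensMeasurableSpace Z]
      {μ : Measure Z} [μ.IsOpenPosMeasure] [IsFiniteMeasureOnCompacts μ] (u : C_c(Z, ℝ))
      (hu : ∀ z, u z ∈ Icc 0 1) {z : Z} (hz : u z = 1) : 0 < ∫ z, u z ∂μ :=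
    u.continuous.integral_pos_of_hasCompactSupport_nonneg_nonzero u.hasCompactSupport
      (fun z => (hu z).1) (hz.trans_ne one_ne_zero)
  have hvpos : 0 < ∫ x, v x ∂m := integral_pos v hv (hvC hx₀)
  have hwpos : 0 < ∫ b, w b ∂m' := integral_pos w hw (hw1 rfl)
  have hCpos : 0 < m.real C := ENNReal.toReal_pos hmC.ne' hC.measure_ne_top
  refine ⟨1 / 2 * m.real C * (∫ b, w b ∂m') / ∫ x, v x ∂m, by positivity, fun f hf1 hf => ?_⟩
  rw [div_le_iff₀ hvpos]
  exact hS.half_measureReal_mul_integral_le hm hH hm' hC v (fun t => (hv t).1) w hw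
    (hwY.trans (image_mono hY)) f hf hf1

theorem measure_image_proj_pos {C : Set K} (hC : IsCompact C) (hmC : 0 < m C) :
    0 < m' (S.proj H '' C) := by
  have hH' := ConvData.isSubhypergroup_of_isSubgroup_or_isCompact hH
  have := hS.t2Space_quot hH'
  have := hS.locallyCompactSpace_quot hH'
  have := hm'.finiteOnCompacts
  have := hm'.innerRegular
  obtain ⟨c, hc, hle⟩ := hS.exists_pos_forall_le_integral hm hH hm' hC hmC
  exact (ENNReal.ofReal_pos.2 hc).trans_le
    (ofReal_le_measure_of_forall_le_integral (hC.image (S.continuous_proj H)) hle)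

theorem quasiMeasurePreserving_proj : Measure.QuasiMeasurePreserving (S.proj H) m m' := by
  have hp := (S.continuous_proj H).measurable
  have := hm.innerRegular
  refine ⟨hp, .mk fun N hN hm'N => ?_⟩
  rw [Measure.map_apply hp hN]
  by_contra hne
  obtain ⟨C, hCN, hC, hmC⟩ := (hp hN).exists_lt_isCompact (pos_iff_ne_zero.2 hne)
  exact (hS.measure_image_proj_pos hm hH hm' hC hmC).ne'
    (measure_mono_null (image_subset_iff.2 hCN) hm'N)

end Nonsingular

end Nonsingularity

/-! ### Smearing and functionals -/

section SmearLpTop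

variable {𝕜 : Type*} [RCLike 𝕜] {m : Measure K} (hm : S.IsHaar m) (v : C_c(K, ℝ))

theorem shift_smear_Lp [IsFiniteMeasureOnCompacts m] (f : Lp 𝕜 ⊤ m) (z x : K) :
    S.shift z (S.smear m v f) x = S.smear m (hS.shiftCc (S.inv z) v) f x :=
  hS.shift_smear v (Lp.aestronglyMeasurable f) (ae_norm_coeFn_le_norm f) z x

theorem integrable_shift_smul [IsFiniteMeasureOnCompacts m] (f : Lp 𝕜 ⊤ m) (x : K) :
    Integrable (fun y => S.shift x v y • f y) m :=
  (integrable_of_compactlySupported (hS.shiftCc x v) m).smul_of_top_left (Lp.memLp f)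

theorem smear_sub [IsFiniteMeasureOnCompacts m] (w : C_c(K, ℝ)) (f : Lp 𝕜 ⊤ m) (x : K) :
    S.smear m (v - w) f x = S.smear m v f x - S.smear m w f x := by
  refine Eq.trans ?_ (integral_sub (hS.integrable_shift_smul v f _)
    (hS.integrable_shift_smul w f _))
  simp only [← sub_smul]
  refine integral_congr_ae (.of_forall fun y => congrArg (· • f y) ?_)
  exact integral_sub (hS.integrable_conv (map_continuous v) _ _)
    (hS.integrable_conv (map_continuous w) _ _)

include hm

theorem integral_abs_shift_le (x : K) : ∫ y, |S.shift x v y| ∂m ≤ ∫ y, |v y| ∂m := by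
  have := hm.finiteOnCompacts
  let w : C_c(K, ℝ) := ⟨⟨fun y => |v y|, (map_continuous v).abs⟩,
    v.hasCompactSupport.comp_left abs_zero⟩
  calc ∫ y, |S.shift x v y| ∂m ≤ ∫ y, S.shift x w y ∂m :=
        integral_mono (integrable_of_compactlySupported (hS.shiftCc x v) m).abs
          (integrable_of_compactlySupported (hS.shiftCc x w) m)
          fun y => abs_integral_le_integral_abs
    _ = ∫ y, |v y| ∂m := hm.integral_shift x w

theorem norm_smear_le (f : Lp 𝕜 ⊤ m) (x : K) : ‖S.smear m v f x‖ ≤ (∫ y, |v y| ∂m) * ‖f‖ := by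
  have := hm.finiteOnCompacts
  refine (norm_integral_smul_le_integral_abs_mul_norm
    (integrable_of_compactlySupported (hS.shiftCc (S.inv x) v) m) f).trans ?_
  exact mul_le_mul_of_nonneg_right (hS.integral_abs_shift_le hm v _) (norm_nonneg f)

theorem norm_shift_smear_sub_le (f : Lp 𝕜 ⊤ m) (z x y : K) :
    ‖S.shift z (S.smear m v f) y - S.shift x (S.smear m v f) y‖
      ≤ (∫ t, |S.shift (S.inv z) v t - S.shift (S.inv x) v t| ∂m) * ‖f‖ := by
  have := hm.finiteOnCompacts
  rw [hS.shift_smear_Lp v f, hS.shift_smear_Lp v f, ← hS.smear_sub]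
  exact hS.norm_smear_le hm (hS.shiftCc (S.inv z) v - hS.shiftCc (S.inv x) v) f y

omit hm in
theorem tendsto_integral_abs_shift_inv_sub_mul [IsFiniteMeasureOnCompacts m] (C : ℝ) (x : K) :
    Tendsto (fun z => (∫ t, |S.shift (S.inv z) v t - S.shift (S.inv x) v t| ∂m) * C)
      (𝓝 x) (𝓝 0) := by
  simpa only [zero_mul] using! ((hS.tendsto_integral_abs_shift_sub (m := m) v (S.inv x)).comp
    hS.continuous_inv.continuousAt).mul_const C

theorem continuous_smear_Lp (f : Lp 𝕜 ⊤ m) : Continuous (S.smear m v f) := by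
  have := hm.finiteOnCompacts
  refine continuous_iff_continuousAt.2 fun x => tendsto_iff_norm_sub_tendsto_zero.2 ?_
  refine squeeze_zero (fun _ => norm_nonneg _) (fun z => ?_)
    (hS.tendsto_integral_abs_shift_inv_sub_mul (m := m) v ‖f‖ x)
  have hone (w : K) : S.shift w (S.smear m v f) S.one = S.smear m v f w := by
    rw [hS.shift_swap, hS.shift_one]
  simpa only [hone] using hS.norm_shift_smear_sub_le hm v f z x S.one

/-- The operator `L^∞(K) → C^b(K)` of smearing with the kernel `v`. -/
def smearCLM : Lp 𝕜 ⊤ m →L[𝕜] (K →ᵇ 𝕜) :=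
  have := hm.finiteOnCompacts
  LinearMap.mkContinuous
    { toFun f := .ofNormedAddCommGroup (S.smear m v f) (hS.continuous_smear_Lp hm v f) _
        (hS.norm_smear_le hm v f)
      map_add' f g := BoundedContinuousFunction.ext fun x => by
        refine Eq.trans (integral_congr_ae ?_) (integral_add (hS.integrable_shift_smul v f _)
          (hS.integrable_shift_smul v g _))
        filter_upwards [Lp.coeFn_add f g] with y hy
        rw [hy, Pi.add_apply, smul_add]
      map_smul' c f := BoundedContinuousFunction.ext fun x => by
        refine Eq.trans (integral_congr_ae ?_) (integral_const_mul c _)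
        filter_upwards [Lp.coeFn_smul c f] with y hy
        rw [hy, Pi.smul_apply, smul_eq_mul, mul_smul_comm] }
    (∫ y, |v y| ∂m) fun f => BoundedContinuousFunction.norm_ofNormedAddCommGroup_le _
      (by positivity) (hS.norm_smear_le hm v f)

theorem continuous_shiftCLM_smearCLM (f : Lp 𝕜 ⊤ m) :
    Continuous fun x => hS.shiftCLM 𝕜 x (hS.smearCLM hm v f) := by
  have := hm.finiteOnCompacts
  refine continuous_iff_continuousAt.2 fun x => tendsto_iff_norm_sub_tendsto_zero.2 ?_
  refine squeeze_zero (fun _ => norm_nonneg _) (fun z => ?_)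
    (hS.tendsto_integral_abs_shift_inv_sub_mul (m := m) v ‖f‖ x)
  exact (BoundedContinuousFunction.norm_le (by positivity)).2
    (hS.norm_shift_smear_sub_le hm v f z x)

variable {v} (hv : ∀ t, 0 ≤ v t)

include hv

theorem smearCLM_eq_shiftCLM_smearCLM {f g : Lp 𝕜 ⊤ m} {z : K} (hg : g =ᵐ[m] S.shift z f) :
    hS.smearCLM hm v g = hS.shiftCLM 𝕜 z (hS.smearCLM hm v f) := by
  have := hm.finiteOnCompacts
  ext x
  calc S.smear m v g x = ∫ y, S.shift (S.inv x) v y • S.shift z f y ∂m :=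
        integral_congr_ae (hg.mono fun y hy => by simp only [hy])
    _ = ∫ y, S.shift (S.inv z) (S.shift (S.inv x) v) y • f y ∂m :=
        hS.integral_smul_shift hm z (hS.shiftCc (S.inv x) v) (S.shift_nonneg hv _)
          (Lp.aestronglyMeasurable f) (ae_norm_coeFn_le_norm f)
    _ = S.smear m (S.shift (S.inv z) v) f x := by
        simp only [hS.shift_shift_comm v (S.inv z), ConvData.smear]
    _ = S.shift z (S.smear m v f) x := (hS.shift_smear_Lp v f z x).symm

theorem smearCLM_bcfToLpTop_of_isCharacter {α : K →ᵇ ℂ} (hα : S.IsCharacter α) :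
    hS.smearCLM hm v (bcfToLpTop m α) = (∫ y, v y • α y ∂m) • α := by
  ext x
  calc S.smear m v (bcfToLpTop m α) x = ∫ y, S.shift (S.inv x) v y • α y ∂m :=
        integral_congr_ae ((coeFn_bcfToLpTop α).mono fun y hy => by simp only [hy])
    _ = ∫ y, v y • S.shift x α y ∂m :=
        (hS.integral_smul_shift hm x v hv α.continuous.aestronglyMeasurable
          (.of_forall α.norm_coe_le_norm)).symm
    _ = ∫ y, (v y • α y) * α x ∂m := by
        simp only [show ∀ y, S.shift x α y = α x * α y from hα.map_conv x, smul_mul_assoc,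
          mul_comm (α x)]
    _ = (∫ y, v y • α y ∂m) * α x := integral_mul_const _ _

end SmearLpTop

section Character

variable {α : K →ᵇ ℂ} (hα : S.IsCharacter α)

include hα

theorem character_one : α S.one = 1 := by
  obtain ⟨x, hx⟩ := DFunLike.ne_iff.1 hα.ne_zero
  have h : S.shift S.one α x = α S.one * α x := hα.map_conv S.one x
  exact (mul_eq_right₀ hx).1 (h.symm.trans (hS.shift_one α x))

theorem shiftCLM_character (x : K) : hS.shiftCLM ℂ x α = α x • α :=
  BoundedContinuousFunction.ext (hα.map_conv x)

theorem exists_integral_smul_character_ne_zero {m : Measure K} (hm : S.IsHaar m) :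
    ∃ v : C_c(K, ℝ), (∀ t, 0 ≤ v t) ∧ ∫ y, v y • α y ∂m ≠ 0 := by
  have := hm.finiteOnCompacts
  have := hS.isOpenPosMeasure hm
  obtain ⟨v, hv1, hvU, hv⟩ := exists_bump (isCompact_singleton (x := S.one))
    (isOpen_lt continuous_const (Complex.continuous_re.comp α.continuous) :
      IsOpen {t | 0 < (α t).re})
    (singleton_subset_iff.2 (by simp [hS.character_one hα]))
  refine ⟨v, fun t => (hv t).1, fun h0 => ?_⟩
  have hc : Continuous fun y => v y • α y := (map_continuous v).smul α.continuous
  have hint : Integrable (fun y => v y • α y) m :=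
    hc.integrable_of_hasCompactSupport v.hasCompactSupport.smul_right
  have hpos : 0 < ∫ y, (v y • α y).re ∂m := by
    refine (Complex.continuous_re.comp hc).integral_pos_of_hasCompactSupport_nonneg_nonzero
      (v.hasCompactSupport.smul_right.comp_left Complex.zero_re) (fun y => ?_) (x := S.one) ?_
    · by_cases hy : v y = 0
      · simp [hy]
      · simpa using mul_nonneg (hv y).1 (hvU (subset_tsupport _ hy)).le
    · simp [hv1 rfl, hS.character_one hα]
  have hre : ∫ y, (v y • α y).re ∂m = (∫ y, v y • α y ∂m).re := integral_re hint
  rw [hre, h0, Complex.zero_re] at hpos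
  exact hpos.false

theorem exists_invariant_functional_character {H : Set K} (hαH : ∀ h ∈ H, α h = 1) :
    ∃ μ : (K →ᵇ ℂ) →L[ℂ] ℂ, μ α = 1 ∧ ∀ h ∈ H, ∀ f, μ (hS.shiftCLM ℂ h f) = μ f := by
  obtain ⟨μ, hμα, hμ⟩ := exists_invariant_functional (𝒯 := hS.shiftCLM ℂ '' H) (v := α)
    (by rintro _ ⟨x, -, rfl⟩ _ ⟨y, -, rfl⟩; exact hS.commute_shiftCLM x y)
    (by
      rintro _ ⟨h, hh, rfl⟩
      exact ⟨hS.norm_shiftCLM_le h, by rw [hS.shiftCLM_character hα, hαH h hh, one_smul]⟩)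
    hα.ne_zero
  exact ⟨μ, hμα, fun h hh => hμ _ (mem_image_of_mem _ hh)⟩

end Character

section OrbitFunctional

variable {𝕜 E : Type*} [RCLike 𝕜] [SeminormedAddCommGroup E] [NormedSpace 𝕜 E]
  (μ : (K →ᵇ 𝕜) →L[𝕜] 𝕜) (Φ : E →L[𝕜] (K →ᵇ 𝕜))
  (hΦ : ∀ f, Continuous fun x => hS.shiftCLM 𝕜 x (Φ f))

/-- The operator that sends `f` to the function `x ↦ μ(T_x Φ(f))`. -/
def orbitCLM : E →L[𝕜] (K →ᵇ 𝕜) :=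
  have hbound (f : E) (x : K) : ‖μ (hS.shiftCLM 𝕜 x (Φ f))‖ ≤ ‖μ‖ * ‖Φ‖ * ‖f‖ := by
    rw [mul_assoc]
    refine μ.le_of_opNorm_le_of_le le_rfl ?_
    exact ((hS.shiftCLM 𝕜 x).le_of_opNorm_le (hS.norm_shiftCLM_le x) _).trans
      (by rw [one_mul]; exact Φ.le_opNorm f)
  LinearMap.mkContinuous
    { toFun f := .ofNormedAddCommGroup (fun x => μ (hS.shiftCLM 𝕜 x (Φ f)))
        (μ.continuous.comp (hΦ f)) _ (hbound f)
      map_add' f g := BoundedContinuousFunction.ext fun x => by simp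
      map_smul' c f := BoundedContinuousFunction.ext fun x => by simp }
    (‖μ‖ * ‖Φ‖) fun f => BoundedContinuousFunction.norm_ofNormedAddCommGroup_le _ (by positivity)
      (hbound f)

theorem shift_orbitCLM (f : E) (z x : K) :
    S.shift z (hS.orbitCLM μ Φ hΦ f) x = μ (hS.shiftCLM 𝕜 z (hS.shiftCLM 𝕜 x (Φ f))) := by
  have := hS.isProbability z x
  have := hS.regular z x
  have hint : Integrable (fun w => hS.shiftCLM 𝕜 w (Φ f)) (S.conv z x) :=
    integrable_of_isCompact_support (hS.isCompact_support z x) (hΦ f)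
  have hconv : ∫ w, hS.shiftCLM 𝕜 w (Φ f) ∂S.conv z x
      = hS.shiftCLM 𝕜 z (hS.shiftCLM 𝕜 x (Φ f)) := by
    ext y
    rw [coe_shiftCLM, coe_shiftCLM, hS.shift_shift]
    exact ((BoundedContinuousFunction.evalCLM 𝕜 y).integral_comp_comm hint).symm
  rw [← hconv]
  exact μ.integral_comp_comm hint

end OrbitFunctional

/-! ### Amenability of the quotient -/

section Amenability

variable {H : Set K} (hH : S.IsSubgroup H ∨ (S.IsSubhypergroup H ∧ IsCompact H))

include hH

theorem isCharacter_pullback {γ : S.QuotSpace H →ᵇ ℂ} (hγ : (S.quot H).IsCharacter γ) :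
    S.IsCharacter (S.pullback H γ) where
  ne_zero h0 := hγ.ne_zero <| BoundedContinuousFunction.ext fun a => by
    rw [← S.proj_rep H a]
    exact DFunLike.congr_fun h0 (S.rep H a)
  map_conv x y := (hS.quot_shift_proj_of_continuous hH γ.continuous x y).symm.trans
    (hγ.map_conv (S.proj H x) (S.proj H y))
  map_inv x := (congrArg γ (hS.quot_inv_proj hH x)).symm.trans (hγ.map_inv (S.proj H x))

theorem isAmenable_quot_of_isAmenable {m : Measure K} (hm : S.IsHaar m)
    {m' : Measure (S.QuotSpace H)} (hm' : (S.quot H).IsHaar m') {γ : S.QuotSpace H →ᵇ ℂ}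
    (h : S.IsAmenable m (S.pullback H γ)) : (S.quot H).IsAmenable m' γ := by
  have hp := hS.quasiMeasurePreserving_proj hm hH hm'
  refine h.of_intertwining (compLpTop hp ℂ) (Lp.ext ?_) fun a => ⟨S.rep H a, ?_, fun f g hg => ?_⟩
  · exact (coeFn_compLpTop hp ℂ _).trans
      ((hp.ae_eq_comp (coeFn_bcfToLpTop γ)).trans (coeFn_bcfToLpTop (S.pullback H γ)).symm)
  · exact congrArg γ (S.proj_rep H a)
  · calc compLpTop hp ℂ g =ᵐ[m] g ∘ S.proj H := coeFn_compLpTop hp ℂ g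
      _ =ᵐ[m] (S.quot H).shift a f ∘ S.proj H := hp.ae_eq_comp hg
      _ = S.shift (S.rep H a) (f ∘ S.proj H) := funext fun y => by
        rw [Function.comp_apply, ← hS.quot_shift_proj hH
          (Lp.stronglyMeasurable f).aestronglyMeasurable, S.proj_rep]
      _ =ᵐ[m] S.shift (S.rep H a) (compLpTop hp ℂ f) :=
        hS.shift_congr_ae hm _ (coeFn_compLpTop hp ℂ f).symm

section Descent

variable {𝕜 : Type*} [RCLike 𝕜]

theorem eq_of_proj_eq_of_shift_eq_bcf {F : K →ᵇ 𝕜} (hF : ∀ h ∈ H, ∀ x, S.shift h F x = F x)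
    {x y : K} (hxy : S.proj H x = S.proj H y) : F x = F y := by
  refine RCLike.ext ?_ ?_
  · refine hS.eq_of_proj_eq_of_shift_eq hH (RCLike.continuous_re.comp F.continuous)
      (fun h hh t => ?_) hxy
    exact (hS.re_shift F.continuous h t).symm.trans (congrArg RCLike.re (hF h hh t))
  · refine hS.eq_of_proj_eq_of_shift_eq hH (RCLike.continuous_im.comp F.continuous)
      (fun h hh t => ?_) hxy
    exact (hS.im_shift F.continuous h t).symm.trans (congrArg RCLike.im (hF h hh t))

variable {E : Type*} [SeminormedAddCommGroup E] [NormedSpace 𝕜 E]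
  {μ : (K →ᵇ 𝕜) →L[𝕜] 𝕜} {Φ : E →L[𝕜] (K →ᵇ 𝕜)}
  (hΦ : ∀ f, Continuous fun x => hS.shiftCLM 𝕜 x (Φ f))

include hΦ

theorem exists_clm_apply_proj_eq_of_invariant
    (hμ : ∀ h ∈ H, ∀ f, μ (hS.shiftCLM 𝕜 h f) = μ f) :
    ∃ D : E →L[𝕜] (S.QuotSpace H →ᵇ 𝕜), ∀ f x,
      D f (S.proj H x) = μ (hS.shiftCLM 𝕜 x (Φ f)) := by
  have hq := hS.isOpenQuotientMap_proj (ConvData.isSubhypergroup_of_isSubgroup_or_isCompact hH)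
  exact exists_clm_forall_apply_eq_of_isQuotientMap hq.isQuotientMap (hS.orbitCLM μ Φ hΦ)
    fun f x y hxy => hS.eq_of_proj_eq_of_shift_eq_bcf hH
      (fun h hh t => (hS.shift_orbitCLM μ Φ hΦ f h t).trans (hμ h hh _)) hxy

theorem eq_quot_shift_of_eq_shiftCLM {D : E →L[𝕜] (S.QuotSpace H →ᵇ 𝕜)}
    (hD : ∀ f x, D f (S.proj H x) = μ (hS.shiftCLM 𝕜 x (Φ f))) {f g : E} {z : K}
    (hg : Φ g = hS.shiftCLM 𝕜 z (Φ f)) :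
    ⇑(D g) = (S.quot H).shift (S.proj H z) (D f) := by
  have hDf : D f ∘ S.proj H = hS.orbitCLM μ Φ hΦ f := funext (hD f)
  ext a
  rw [← S.proj_rep H a, hD, hg, hS.quot_shift_proj_of_continuous hH (D f).continuous, hDf,
    hS.shift_orbitCLM]
  exact congrArg μ (DFunLike.congr_fun (hS.commute_shiftCLM _ z) (Φ f))

end Descent

theorem exists_intertwining_quot {m : Measure K} (hm : S.IsHaar m) {γ : S.QuotSpace H →ᵇ ℂ}
    (hγ : (S.quot H).IsCharacter γ) :
    ∃ D : Lp ℂ ⊤ m →L[ℂ] (S.QuotSpace H →ᵇ ℂ), D (bcfToLpTop m (S.pullback H γ)) = γ ∧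
      ∀ z, ∀ f g : Lp ℂ ⊤ m, g =ᵐ[m] S.shift z f →
        ⇑(D g) = (S.quot H).shift (S.proj H z) (D f) := by
  have hH' := ConvData.isSubhypergroup_of_isSubgroup_or_isCompact hH
  have hα := hS.isCharacter_pullback hH hγ
  have hαH : ∀ h ∈ H, S.pullback H γ h = 1 := fun h hh =>
    (congrArg γ ((hS.proj_eq_proj_one_iff hH').2 hh)).trans (hS.character_one hα)
  obtain ⟨v, hv, hc⟩ := hS.exists_integral_smul_character_ne_zero hα hm
  obtain ⟨μ, hμα, hμ⟩ := hS.exists_invariant_functional_character hα hαH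
  have hΦ := hS.continuous_shiftCLM_smearCLM (𝕜 := ℂ) hm v
  obtain ⟨D, hD⟩ := hS.exists_clm_apply_proj_eq_of_invariant hH hΦ
    (μ := (∫ y, v y • S.pullback H γ y ∂m)⁻¹ • μ) fun h hh f => congrArg (_ * ·) (hμ h hh f)
  refine ⟨D, ?_, fun z f g hg => hS.eq_quot_shift_of_eq_shiftCLM hH hΦ hD
    (hS.smearCLM_eq_shiftCLM_smearCLM hm hv hg)⟩
  ext a
  rw [← S.proj_rep H a, hD, hS.smearCLM_bcfToLpTop_of_isCharacter hm hv hα, map_smul,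
    hS.shiftCLM_character hα, smul_apply, map_smul, map_smul, hμα, inv_smul_smul₀ hc]
  exact mul_one _

theorem isAmenable_of_isAmenable_quot {m : Measure K} (hm : S.IsHaar m)
    {m' : Measure (S.QuotSpace H)} (hm' : (S.quot H).IsHaar m') {γ : S.QuotSpace H →ᵇ ℂ}
    (hγ : (S.quot H).IsCharacter γ) (h : (S.quot H).IsAmenable m' γ) :
    S.IsAmenable m (S.pullback H γ) := by
  have hH' := ConvData.isSubhypergroup_of_isSubgroup_or_isCompact hH
  have := hS.t2Space_quot hH'
  have := hS.locallyCompactSpace_quot hH'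
  have hquot := hS.isCommHypergroup_quot hH
  obtain ⟨D, hDγ, hD⟩ := hS.exists_intertwining_quot hH hm hγ
  refine h.of_intertwining ((bcfToLpTop m').comp D) (congrArg (bcfToLpTop m') hDγ) fun z =>
    ⟨S.proj H z, rfl, fun f g hg => ?_⟩
  calc bcfToLpTop m' (D g) =ᵐ[m'] D g := coeFn_bcfToLpTop _
    _ = (S.quot H).shift (S.proj H z) (D f) := hD z f g hg
    _ =ᵐ[m'] (S.quot H).shift (S.proj H z) (bcfToLpTop m' (D f)) :=
      hquot.shift_congr_ae hm' _ (coeFn_bcfToLpTop _).symm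

end Amenability

end IsCommHypergroup

end

theorem mainTheorem4 {K : Type*} [TopologicalSpace K] [T2Space K] [LocallyCompactSpace K]
    [MeasurableSpace K] [BorelSpace K] (S : ConvData K) (hS : IsCommHypergroup S)
    (H : Set K) (hH : S.IsSubgroup H ∨ (S.IsSubhypergroup H ∧ IsCompact H))
    (m : Measure K) (hm : S.IsHaar m)
    (m' : Measure (S.QuotSpace H)) (hm' : (S.quot H).IsHaar m')
    (γ : S.QuotSpace H →ᵇ ℂ) (hγ : (S.quot H).IsCharacter γ) :
    S.IsCharacter (S.pullback H γ) ∧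
      ((S.quot H).IsAmenable m' γ ↔ S.IsAmenable m (S.pullback H γ)) :=
  ⟨hS.isCharacter_pullback hH hγ, hS.isAmenable_of_isAmenable_quot hH hm hm' hγ,
    hS.isAmenable_quot_of_isAmenable hH hm hm'⟩
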